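/- Setting (GXSTPIR). Let $\mathbb F_q$ be a finite field, $N,M$ positive integers, $\mathcal R_1,\dots,\mathcal R_M\subseteq[N]$, $\rho_m=|\mathcal R_m|$, $\rho_{\min}=\min_m\rho_m$, and let $X\ge 0$, $T\ge 1$ be integers with $\rho_{\min}>X+T$. There are $N$ servers and, for each $m\in[M]$, $K_m$ messages $W_{m,k}$, $k\in[K_m]$. All messages are independent, each consisting of $L\ge1$ i.i.d. uniform symbols of $\mathbb F_q$. All random variables below take finitely many values and entropies are in $q$-ary units. A feasible scheme consists of the following. (i) Shares $W_{m,k}^{(n)}$, $n\in\mathcal R_m$, of every message. The share tuples $\overline W_{m,k}=(W_{m,k}^{(n)})_{n\in\mathcal R_m}$ are independent over $(m,k)$, and $H(W_{m,k}\mid\overline W_{m,k})=0$. If $X=0$, each share is the message itself. Server $n$ stores $S_n=\{W_{m,k}^{(n)}: n\in\mathcal R_m\}$, and $I(S_{\mathcal X};\mathcal W)=0$ for all $\mathcal X\subseteq[N]$ with $|\mathcal X|\le X$, where $\mathcal W$ denotes all messages ($X$-security). (ii) A desired index $(\mu,\kappa)$, with $\mu$ uniform on $[M]$ and $\kappa$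 uniform on $[K_\mu]$ given $\mu$, and queries $Q_n^{[m,k]}$ such that $(S_1,\dots,S_N)$ is independent of $(\mu,\kappa)$ and all the queries jointly. Moreover $I(Q_{\mathcal T}^{[\mu,\kappa]};\mu,\kappa)=0$ for all $\mathcal T\subseteq[N]$ with $|\mathcal T|\le T$ ($T$-privacy). (iii) Answers $A_n^{[\mu,\kappa]}$, each a fixed function (depending on $n$ only) of $Q_n^{[\mu,\kappa]}$ and $S_n$, such that $H(W_{\mu,\kappa}\mid A_{[N]}^{[\mu,\kappa]},Q_{[N]}^{[\mu,\kappa]},\mu,\kappa)=0$ (correctness). The rate of the scheme is $L/\sum_{n}H(A_n^{[\mu,\kappa]})$, and the capacity $C$ is the supremum of the rates of all feasible schemes (over all $L$). Fix constants $\chi_m>0$ and let $K_m=\lceil\chi_mK\rceil$. The asymptotic capacity is $C_\infty=\lim_{K\to\infty}C$. Let $$\mathcal D=\Big\{D\in\mathbb R_{\ge0}^N:\ \sum_{n\in\mathcal R'}D_n\ge1\ \text{ for all } m\in[M],\ \mathcal R'\subseteq\mathcal R_m,\ |\mathcal R'|=\rho_m-X-T\Big\},$$ and let $\mathcal G$ be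 the hypergraph with vertex set $[N]$ whose hyperedges are the sets $e$ for which there is $m\in[M]$ with $e\subseteq\mathcal R_m$ and $|e|=\rho_m-X-T$. A fractional matching of $\mathcal G$ is an assignment of weights $x_e\ge0$ to the hyperedges such that $\sum_{e\ni v}x_e\le1$ for every $v\in[N]$. The fractional matching number $\nu$ of $\mathcal G$ is the largest total weight $\sum_e x_e$ of a fractional matching. Statement. 1. The maximum defining $\nu$, the minimum $\min_{D\in\mathcal D}(D_1+\cdots+D_N)$ and the maximum $\max_{D\in\mathcal D}(D_1+\cdots+D_N)^{-1}$ are attained, and $\min_{D\in\mathcal D}(D_1+\cdots+D_N)=\nu$. 2. The lower bound $\frac{\rho_{\min}-X-T}{N}$ on $C_\infty$ equals the upper bound $\max_{D\in\mathcal D}(D_1+\cdots+D_N)^{-1}$ on $C_\infty$ if and only if $\nu=\frac{N}{\rho_{\min}-X-T}$. 3. If $\nu=\frac{N}{\rho_{\min}-X-T}$, then the limit $C_\infty$ exists and $C_\infty=\frac{\rho_{\min}-X-T}{N}$. -/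

import Mathlib

open scoped ENNReal

namespace GXSTPIR

/-! ### Shannon quantities of finitely-valued random variables on a discrete probability space -/

/-- Shannon entropy `H(Y)` in `q`-ary units. -/
noncomputable def entropy {Ω α : Type*} [Fintype α] (q : ℕ) (P : PMF Ω) (Y : Ω → α) : ℝ :=
  ∑ y : α, Real.negMulLog (P.map Y y).toReal / Real.log q

/-- Conditional entropy `H(Y ∣ Z) = H(Y, Z) - H(Z)`. -/
noncomputable def condEntropy {Ω α β : Type*} [Fintype α] [Fintype β] (q : ℕ) (P : PMF Ω)
    (Y : Ω → α) (Z : Ω → β) : ℝ :=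
  entropy q P (fun ω => (Y ω, Z ω)) - entropy q P Z

/-- Mutual information `I(Y ; Z) = H(Y) + H(Z) - H(Y, Z)`. -/
noncomputable def mutualInfo {Ω α β : Type*} [Fintype α] [Fintype β] (q : ℕ) (P : PMF Ω)
    (Y : Ω → α) (Z : Ω → β) : ℝ :=
  entropy q P Y + entropy q P Z - entropy q P (fun ω => (Y ω, Z ω))

/-! ### Retrieval schemes -/

/-- Indices `(m, k)` of the messages `W_{m,k}`, `m ∈ [M]`, `k ∈ [K_m]`. -/
abbrev MsgIdx {M : ℕ} (K : Fin M → ℕ) : Type := Σ m : Fin M, Fin (K m)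

/-- The random variables of a scheme, before the constraints are imposed. The messages of the
`m`-th set are stored (as shares) exactly at the servers in `R m`. -/
structure Scheme (F : Type) {N M : ℕ} (R : Fin M → Finset (Fin N)) (K : Fin M → ℕ) where
  /-- sample space -/
  Ω : Type
  /-- probability distribution -/
  P : PMF Ω
  /-- number of symbols of `F` in each message -/
  L : ℕ
  /-- alphabet of the shares -/
  Share : Type
  /-- alphabet of the queries -/
  Query : Type
  /-- alphabet of the answers -/
  Answer : Type
  [fintypeShare : Fintype Share]
  [fintypeQuery : Fintype Query]
  [fintypeAnswer : Fintype Answer]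
  /-- the messages `W_{m,k}` -/
  W : MsgIdx K → Ω → (Fin L → F)
  /-- the shares `W_{m,k}^{(n)}`, `n ∈ R m` -/
  share : (i : MsgIdx K) → {n : Fin N // n ∈ R i.1} → Ω → Share
  /-- the index `(μ, κ)` of the desired message -/
  θ : Ω → MsgIdx K
  /-- the queries `Q_n^{[m,k]}` -/
  Q : Fin N → MsgIdx K → Ω → Query
  /-- the rule by which server `n` computes its answer from the query that it receives and from
  the shares that it stores; it does not see `(μ, κ)` -/
  ans : (n : Fin N) → Query → ({i : MsgIdx K // n ∈ R i.1} → Share) → Answer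

attribute [instance] Scheme.fintypeShare Scheme.fintypeQuery Scheme.fintypeAnswer

namespace Scheme

variable {F : Type} {N M : ℕ} {R : Fin M → Finset (Fin N)} {K : Fin M → ℕ}

/-- All shares `(W_{m,k}^{(n)}, n ∈ R m)` of one message. -/
def shares (s : Scheme F R K) (i : MsgIdx K) : s.Ω → ({n : Fin N // n ∈ R i.1} → s.Share) :=
  fun ω n => s.share i n ω

/-- The content `S_n` of server `n`: its shares of all messages `(m, k)` with `n ∈ R m`. -/
def storage (s : Scheme F R K) (n : Fin N) :
    s.Ω → ({i : MsgIdx K // n ∈ R i.1} → s.Share) :=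
  fun ω i => s.share i.1 ⟨n, i.2⟩ ω

/-- The joint content `S_𝒳` of the servers in `𝒳`. -/
def storageOn (s : Scheme F R K) (𝒳 : Finset (Fin N)) :
    s.Ω → ((n : {n : Fin N // n ∈ 𝒳}) → {i : MsgIdx K // n.1 ∈ R i.1} → s.Share) :=
  fun ω n => s.storage n.1 ω

/-- The query `Q_n^{[μ,κ]}` that is actually sent to server `n`. -/
def sentQuery (s : Scheme F R K) (n : Fin N) : s.Ω → s.Query :=
  fun ω => s.Q n (s.θ ω) ω

/-- The queries actually sent to the servers in `𝒯`. -/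
def sentQueryOn (s : Scheme F R K) (𝒯 : Finset (Fin N)) :
    s.Ω → ({n : Fin N // n ∈ 𝒯} → s.Query) :=
  fun ω n => s.sentQuery n.1 ω

/-- The answer `A_n^{[μ,κ]}` of server `n`. -/
def answer (s : Scheme F R K) (n : Fin N) : s.Ω → s.Answer :=
  fun ω => s.ans n (s.sentQuery n ω) (s.storage n ω)

/-- The expected total download `D = ∑ n, H(A_n^{[μ,κ]})`, in `q`-ary symbols, `q = |F|`. -/
noncomputable def download [Fintype F] (s : Scheme F R K) : ℝ :=
  ∑ n : Fin N, entropy (Fintype.card F) s.P (s.answer n)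

/-- The rate `L / D`. -/
noncomputable def rate [Fintype F] (s : Scheme F R K) : ℝ≥0∞ :=
  (s.L : ℝ≥0∞) / ENNReal.ofReal s.download

/-- The constraints of `X`-secure, `T`-private information retrieval. -/
structure IsFeasible [Fintype F] (s : Scheme F R K) (X T : ℕ) : Prop where
  L_pos : 0 < s.L
  /-- each message consists of `L` i.i.d. uniform symbols -/
  entropy_message : ∀ i, entropy (Fintype.card F) s.P (s.W i) = s.L
  /-- the messages are independent -/
  entropy_messages : entropy (Fintype.card F) s.P (fun ω i => s.W i ω) = ∑ m, (K m : ℝ) * s.L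
  /-- the messages are secured independently of each other -/
  entropy_shares : entropy (Fintype.card F) s.P (fun ω i => s.shares i ω) =
    ∑ i, entropy (Fintype.card F) s.P (s.shares i)
  /-- each message is recoverable from its shares -/
  recoverable : ∀ i, condEntropy (Fintype.card F) s.P (s.W i) (s.shares i) = 0
  /-- `X`-security -/
  secure : ∀ 𝒳 : Finset (Fin N), 𝒳.card ≤ X →
    mutualInfo (Fintype.card F) s.P (s.storageOn 𝒳) (fun ω i => s.W i ω) = 0
  /-- without security constraint each share is (an injective relabelling of) the message -/
  plain : X = 0 → ∀ (i : MsgIdx K) (n : {n : Fin N // n ∈ R i.1}),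
    ∃ e : (Fin s.L → F) ↪ s.Share, ∀ ω, s.share i n ω = e (s.W i ω)
  /-- `μ` is uniform on `[M]` and, given `μ`, `κ` is uniform on `[K_μ]` -/
  uniform_index : ∀ i : MsgIdx K, (s.P.map s.θ i).toReal = 1 / ((M : ℝ) * K i.1)
  /-- the user has no prior knowledge of the stored data -/
  no_prior_knowledge : mutualInfo (Fintype.card F) s.P (s.storageOn Finset.univ)
    (fun ω => (s.θ ω, fun (i : MsgIdx K) (n : Fin N) => s.Q n i ω)) = 0
  /-- `T`-privacy -/
  isPrivate : ∀ 𝒯 : Finset (Fin N), 𝒯.card ≤ T →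
    mutualInfo (Fintype.card F) s.P (s.sentQueryOn 𝒯) s.θ = 0
  /-- correctness -/
  correct : condEntropy (Fintype.card F) s.P (fun ω => s.W (s.θ ω) ω)
    (fun ω => (fun n : Fin N => s.answer n ω, fun n : Fin N => s.sentQuery n ω, s.θ ω)) = 0

end Scheme

/-- The capacity: the supremum of the rates of all feasible schemes. -/
noncomputable def capacity (F : Type) [Fintype F] {N M : ℕ} (R : Fin M → Finset (Fin N))
    (X T : ℕ) (K : Fin M → ℕ) : ℝ≥0∞ :=
  ⨆ (s : Scheme F R K) (_ : s.IsFeasible X T), s.rate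

/-! ### The two bounds and the hypergraph -/

/-- The minimum replication factor `min_m |R m|` (for `M ≥ 1`; it is `0` when `M = 0`). -/
noncomputable def rhoMin {N M : ℕ} (R : Fin M → Finset (Fin N)) : ℕ := ⨅ m, (R m).card

/-- The lower bound `(ρ_min - X - T) / N` on the asymptotic capacity. -/
noncomputable def achievabilityBound {N M : ℕ} (R : Fin M → Finset (Fin N)) (X T : ℕ) : ℝ :=
  ((rhoMin R : ℝ) - X - T) / N

/-- The polyhedron `𝒟` of the normalized downloads `(D_1, …, D_N)`. -/
def downloadRegion {N M : ℕ} (R : Fin M → Finset (Fin N)) (X T : ℕ) : Set (Fin N → ℝ) :=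
  {D | (∀ n, 0 ≤ D n) ∧
    ∀ (m : Fin M) (R' : Finset (Fin N)), R' ⊆ R m → R'.card + (X + T) = (R m).card →
      1 ≤ ∑ n ∈ R', D n}

/-- The totals `D_1 + ⋯ + D_N` over `𝒟`. -/
def totalDownloads {N M : ℕ} (R : Fin M → Finset (Fin N)) (X T : ℕ) : Set ℝ :=
  (fun D : Fin N → ℝ => ∑ n, D n) '' downloadRegion R X T

/-- The values `(D_1 + ⋯ + D_N)⁻¹` over `𝒟`. -/
def converseValues {N M : ℕ} (R : Fin M → Finset (Fin N)) (X T : ℕ) : Set ℝ :=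
  (fun D : Fin N → ℝ => (∑ n, D n)⁻¹) '' downloadRegion R X T

/-- The upper bound `max_𝒟 (D_1 + ⋯ + D_N)⁻¹` on the asymptotic capacity, for
`ρ_min > X + T`. -/
noncomputable def converseBound {N M : ℕ} (R : Fin M → Finset (Fin N)) (X T : ℕ) : ℝ :=
  sSup (converseValues R X T)

/-- The hyperedges of `𝒢`: the `e ⊆ R m`, for some `m`, with `|R m| - |e| = X + T`. -/
def hyperedges {N M : ℕ} (R : Fin M → Finset (Fin N)) (X T : ℕ) : Finset (Finset (Fin N)) :=
  Finset.univ.filter fun e => ∃ m, e ⊆ R m ∧ e.card + (X + T) = (R m).card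

/-- `x` is a fractional matching of the hypergraph on `V` with hyperedges `E` (values of `x`
outside `E` play no role). -/
def IsFractionalMatching {V : Type*} [DecidableEq V] (E : Finset (Finset V))
    (x : Finset V → ℝ) : Prop :=
  (∀ e ∈ E, 0 ≤ x e) ∧ ∀ v : V, ∑ e ∈ E with v ∈ e, x e ≤ 1

/-- The total weights of the fractional matchings. -/
def matchingWeights {V : Type*} [DecidableEq V] (E : Finset (Finset V)) : Set ℝ :=
  (fun x : Finset V → ℝ => ∑ e ∈ E, x e) '' {x | IsFractionalMatching E x}

/-- The fractional matching number: the largest total weight of a fractional matching. -/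
noncomputable def fractionalMatchingNumber {V : Type*} [DecidableEq V]
    (E : Finset (Finset V)) : ℝ :=
  sSup (matchingWeights E)

end GXSTPIR

/-! Three parts carry the theorem: linear programming duality, an information-theoretic converse,
and a scheme that meets it.

Duality. The polyhedron of downloads consists of the fractional vertex covers of the hypergraph. In
the zero-sum game where one player picks a hyperedge and the other a vertex, with payoff 1 on
incidence, a saddle point divided by the value of the game is both a matching and a cover of the
same weight ν (`exists_matching_cover`). Hence the converse bound is 1/ν, and the equivalence of the
second claim is an inversion.

Converse. Split the servers of one message set into a hyperedge e, at most X servers whose content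
is given away, and at most T servers whose queries reveal nothing about the desired index. Decoding
one message costs L. By privacy the average answer entropy of the T servers does not depend on which
message is wanted, so adding the messages of the set to the conditioning one at a time telescopes
(`le_entropy_answersTo`, `residual_insert`, `converse_hyperedge`). The servers of e therefore send
at least L - D/K_m in total, where D is the whole download. Weighting the hyperedges by an optimal
matching gives L/D ≤ 1/ν + 1/k whenever all K_m ≥ k > 0 (`le_download`, `capacity_le`).

Achievability. Cross-subspace alignment over a large extension field places l = ρ_min - X - T
symbols of each message at distinct poles. Shares and queries are masked by polynomial noise, and
barycentric weights make every undesired product a sum that vanishes by Lagrange interpolation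
(`sum_nodalWeight_mul`). One field symbol per server then yields l desired symbols, so the rate is
at least l/N for any positive numbers of messages (`csaScheme_isFeasible`, `le_capacity`).

When ν = N/l the two bounds squeeze the capacity as K grows. -/

namespace GXSTPIR

/-! ### Laws of random variables and functional dependence on the support -/

section Law

variable {Ω α β γ : Type*} (P : PMF Ω)

/-- The probability that `Y` takes the value `y`. -/
noncomputable def law (Y : Ω → α) (y : α) : ℝ := (P.map Y y).toReal

lemma law_nonneg (Y : Ω → α) (y : α) : 0 ≤ law P Y y := ENNReal.toReal_nonneg

lemma sum_law [Fintype α] (Y : Ω → α) : ∑ y, law P Y y = 1 := by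
  unfold law
  rw [← ENNReal.toReal_sum fun a _ => PMF.apply_ne_top _ _, ← tsum_fintype (L := .unconditional _),
    PMF.tsum_coe, ENNReal.toReal_one]

lemma law_comp [Fintype α] [DecidableEq β] (Y : Ω → α) (f : α → β) (z : β) :
    law P (fun ω => f (Y ω)) z = ∑ y, if f y = z then law P Y y else 0 := by
  unfold law
  have : P.map (fun ω => f (Y ω)) = (P.map Y).map f := by rw [PMF.map_comp]; rfl
  rw [this, PMF.map_apply, tsum_fintype, ENNReal.toReal_sum]
  · refine Finset.sum_congr rfl fun y _ => ?_
    by_cases h : f y = z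
    · simp [h]
    · simp [h, Ne.symm h]
  · intro a _
    split_ifs
    · exact PMF.apply_ne_top _ _
    · simp

lemma sum_law_mul [Fintype α] [Fintype β] (Y : Ω → α) (f : α → β) (φ : β → ℝ) :
    ∑ z, law P (fun ω => f (Y ω)) z * φ z = ∑ y, law P Y y * φ (f y) := by
  classical
  have h : ∀ z, law P (fun ω => f (Y ω)) z * φ z = ∑ y, if f y = z then law P Y y * φ z else 0 := by
    intro z
    rw [law_comp P Y f, Finset.sum_mul]
    simp only [ite_mul, zero_mul]
  rw [Finset.sum_congr rfl fun z _ => h z, Finset.sum_comm]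
  refine Finset.sum_congr rfl fun y _ => ?_
  simp

lemma law_le_comp [Fintype α] (Y : Ω → α) (f : α → β) (y : α) :
    law P Y y ≤ law P (fun ω => f (Y ω)) (f y) := by
  classical
  rw [law_comp P Y f]
  refine le_trans (by simp) (Finset.single_le_sum
    (f := fun y' => if f y' = f y then law P Y y' else 0) (fun i _ => ?_) (Finset.mem_univ y))
  exact ite_nonneg (law_nonneg _ _ _) le_rfl

lemma sum_law_pair_left [Fintype α] [Fintype β] (Y : Ω → α) (Z : Ω → β) (z : β) :
    ∑ y, law P (fun ω => (Y ω, Z ω)) (y, z) = law P Z z := by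
  classical
  have := law_comp P (fun ω => (Y ω, Z ω)) Prod.snd z
  simp only at this
  rw [this, Fintype.sum_prod_type]
  refine Finset.sum_congr rfl fun y _ => ?_
  simp

lemma law_pos_of_mem_support (Y : Ω → α) {ω : Ω} (h : ω ∈ P.support) : 0 < law P Y (Y ω) := by
  refine ENNReal.toReal_pos ?_ (PMF.apply_ne_top _ _)
  exact (PMF.mem_support_iff _ _).1 ((PMF.mem_support_map_iff _ _ _).2 ⟨ω, h, rfl⟩)

lemma exists_mem_support_of_law_pos (Y : Ω → α) {y : α} (h : 0 < law P Y y) :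
    ∃ ω ∈ P.support, Y ω = y := by
  have : y ∈ (P.map Y).support := (PMF.mem_support_iff _ _).2 fun h0 => by simp [law, h0] at h
  exact (PMF.mem_support_map_iff _ _ _).1 this

lemma law_congr {Y Y' : Ω → α} (h : ∀ ω ∈ P.support, Y ω = Y' ω) (y : α) :
    law P Y y = law P Y' y := by
  classical
  unfold law
  rw [PMF.map_apply, PMF.map_apply]
  congr 2
  ext ω
  by_cases hω : ω ∈ P.support
  · rw [h ω hω]
  · have : P ω = 0 := by simpa [PMF.mem_support_iff] using hω
    simp [this]

/-- On the support of `P`, the variable `Y` is a function of `Z`. -/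
def Determines (Z : Ω → β) (Y : Ω → α) : Prop :=
  ∀ ω ∈ P.support, ∀ ω' ∈ P.support, Z ω = Z ω' → Y ω = Y ω'

variable {P} in
lemma Determines.exists_eq {Z : Ω → β} {Y : Ω → α} (h : Determines P Z Y) :
    ∃ f : β → α, ∀ ω ∈ P.support, Y ω = f (Z ω) := by
  classical
  obtain ⟨ω₀, -⟩ := P.support_nonempty
  refine ⟨fun z => if hz : ∃ ω ∈ P.support, Z ω = z then Y hz.choose else Y ω₀, fun ω hω => ?_⟩
  have hz : ∃ ω' ∈ P.support, Z ω' = Z ω := ⟨ω, hω, rfl⟩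
  simp only [dif_pos hz]
  exact h _ hω _ hz.choose_spec.1 hz.choose_spec.2.symm

end Law

/-! ### Shannon inequalities and their equality cases -/

section Entropy

variable {Ω α β γ : Type*} [Fintype α] [Fintype β] [Fintype γ] (q : ℕ) (P : PMF Ω)

lemma entropy_eq_sum (Y : Ω → α) :
    entropy q P Y = (∑ y, law P Y y * -Real.log (law P Y y)) / Real.log q := by
  unfold entropy
  rw [Finset.sum_div]
  refine Finset.sum_congr rfl fun y _ => ?_
  simp [Real.negMulLog, law]

lemma entropy_comp_eq_sum (Y : Ω → α) (f : α → β) :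
    entropy q P (fun ω => f (Y ω)) =
      (∑ y, law P Y y * -Real.log (law P (fun ω => f (Y ω)) (f y))) / Real.log q := by
  rw [entropy_eq_sum, sum_law_mul P Y f fun z => -Real.log (law P (fun ω => f (Y ω)) z)]

lemma entropy_nonneg (Y : Ω → α) : 0 ≤ entropy q P Y := by
  refine Finset.sum_nonneg fun y _ => div_nonneg (Real.negMulLog_nonneg (law_nonneg P Y y) ?_)
    (Real.log_natCast_nonneg q)
  exact ENNReal.toReal_mono ENNReal.one_ne_top (PMF.coe_le_one _ _)

variable {P} in
lemma entropy_congr {Y Y' : Ω → α} (h : ∀ ω ∈ P.support, Y ω = Y' ω) :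
    entropy q P Y = entropy q P Y' := by
  rw [entropy_eq_sum, entropy_eq_sum]
  simp_rw [law_congr P h]

variable {P} in
lemma Determines.entropy_le {Z : Ω → β} {Y : Ω → α} (h : Determines P Z Y) :
    entropy q P Y ≤ entropy q P Z := by
  obtain ⟨f, hf⟩ := h.exists_eq
  rw [entropy_congr q hf, entropy_comp_eq_sum q P Z f, entropy_eq_sum]
  refine div_le_div_of_nonneg_right (Finset.sum_le_sum fun z _ => ?_) (Real.log_natCast_nonneg q)
  rcases (law_nonneg P Z z).eq_or_lt with h0 | h0
  · simp [← h0]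
  · exact mul_le_mul_of_nonneg_left
      (neg_le_neg (Real.log_le_log h0 (law_le_comp P Z f z))) h0.le

variable {P} in
lemma entropy_eq_of_determines {Z : Ω → β} {Y : Ω → α} (h : Determines P Z Y)
    (h' : Determines P Y Z) : entropy q P Y = entropy q P Z :=
  le_antisymm (h.entropy_le q) (h'.entropy_le q)

/-- Gibbs' inequality against the uniform law: `log t ≤ t - 1` at t = 1/(|α| p(y)), with corrections
that sum to zero. -/
lemma entropy_le_log_card (Y : Ω → α) :
    entropy q P Y ≤ Real.log (Fintype.card α) / Real.log q := by
  rw [entropy_eq_sum]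
  refine div_le_div_of_nonneg_right ?_ (Real.log_natCast_nonneg q)
  obtain ⟨ω₀, -⟩ := P.support_nonempty
  have hc : (0 : ℝ) < Fintype.card α := by
    have : Nonempty α := ⟨Y ω₀⟩
    exact_mod_cast Fintype.card_pos
  have key : ∀ y, law P Y y * -Real.log (law P Y y) ≤
      law P Y y * Real.log (Fintype.card α) + ((Fintype.card α : ℝ)⁻¹ - law P Y y) := by
    intro y
    rcases (law_nonneg P Y y).eq_or_lt with h0 | h0
    · simp [← h0]
    · have h1 := Real.log_le_sub_one_of_pos (x := (Fintype.card α : ℝ)⁻¹ / law P Y y) (by positivity)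
      rw [Real.log_div (by positivity) h0.ne', Real.log_inv] at h1
      have h2 := mul_le_mul_of_nonneg_left h1 h0.le
      have h3 : law P Y y * ((Fintype.card α : ℝ)⁻¹ / law P Y y - 1) =
        (Fintype.card α : ℝ)⁻¹ - law P Y y := by field_simp
      linarith
  refine (Finset.sum_le_sum fun y _ => key y).trans (le_of_eq ?_)
  rw [Finset.sum_add_distrib, ← Finset.sum_mul, Finset.sum_sub_distrib, sum_law]
  simp [hc.ne']

lemma entropy_of_uniform (Y : Ω → α) (h : ∀ y, law P Y y = (Fintype.card α : ℝ)⁻¹) :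
    entropy q P Y = Real.log (Fintype.card α) / Real.log q := by
  rw [entropy_eq_sum]
  simp_rw [h]
  obtain ⟨ω₀, -⟩ := P.support_nonempty
  have hc : (Fintype.card α : ℝ) ≠ 0 := by
    have : Nonempty α := ⟨Y ω₀⟩
    exact_mod_cast Fintype.card_ne_zero
  simp [hc]

/-- Submodularity of entropy. -/
lemma entropy_submodular (X : Ω → α) (Y : Ω → β) (Z : Ω → γ) :
    entropy q P (fun ω => (X ω, Y ω, Z ω)) + entropy q P Z ≤
      entropy q P (fun ω => (X ω, Z ω)) + entropy q P (fun ω => (Y ω, Z ω)) := by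
  set U : Ω → α × β × γ := fun ω => (X ω, Y ω, Z ω) with hU
  have e1 := entropy_eq_sum q P U
  have e2 := entropy_comp_eq_sum q P U fun u => u.2.2
  have e3 := entropy_comp_eq_sum q P U fun u => (u.1, u.2.2)
  have e4 := entropy_comp_eq_sum q P U fun u => u.2
  simp only [hU] at e1 e2 e3 e4
  simp only [hU]
  rw [e1, e2, e3, e4, ← add_div, ← add_div, ← Finset.sum_add_distrib, ← Finset.sum_add_distrib]
  refine div_le_div_of_nonneg_right ?_ (Real.log_natCast_nonneg q)
  set p := law P U with hp
  set pxz := law P fun ω => (X ω, Z ω) with hpxz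
  set pyz := law P fun ω => (Y ω, Z ω) with hpyz
  set pz := law P Z with hpz
  -- This is `log t ≤ t - 1` at t = p(x,z) p(y,z) / (p(x,y,z) p(z)). The corrections sum to at most
  -- 0, because the conditionally independent coupling has total mass at most 1.
  have key : ∀ u : α × β × γ, p u * -Real.log (p u) + p u * -Real.log (pz u.2.2) ≤
      p u * -Real.log (pxz (u.1, u.2.2)) + p u * -Real.log (pyz u.2) +
        (pxz (u.1, u.2.2) * pyz u.2 / pz u.2.2 - p u) := by
    intro u
    have n1 : 0 ≤ pxz (u.1, u.2.2) := law_nonneg _ _ _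
    have n2 : 0 ≤ pyz u.2 := law_nonneg _ _ _
    have n3 : 0 ≤ pz u.2.2 := law_nonneg _ _ _
    rcases (law_nonneg P U u).eq_or_lt with h0 | h0
    · rw [← hp] at h0
      rw [← h0]
      have := div_nonneg (mul_nonneg n1 n2) n3
      simpa using this
    · rw [← hp] at h0
      have l1 : 0 < pxz (u.1, u.2.2) := h0.trans_le (law_le_comp P U (fun u => (u.1, u.2.2)) u)
      have l2 : 0 < pyz u.2 := h0.trans_le (law_le_comp P U (fun u => u.2) u)
      have l3 : 0 < pz u.2.2 := h0.trans_le (law_le_comp P U (fun u => u.2.2) u)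
      have h1 := Real.log_le_sub_one_of_pos
        (x := pxz (u.1, u.2.2) * pyz u.2 / (p u * pz u.2.2)) (by positivity)
      rw [Real.log_div (by positivity) (by positivity), Real.log_mul l1.ne' l2.ne',
        Real.log_mul h0.ne' l3.ne'] at h1
      have h2 := mul_le_mul_of_nonneg_left h1 h0.le
      have h3 : p u * (pxz (u.1, u.2.2) * pyz u.2 / (p u * pz u.2.2) - 1) =
        pxz (u.1, u.2.2) * pyz u.2 / pz u.2.2 - p u := by field_simp
      linarith
  refine (Finset.sum_le_sum fun u _ => key u).trans ?_
  rw [Finset.sum_add_distrib, Finset.sum_sub_distrib]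
  have s1 : ∑ u, p u = 1 := sum_law P U
  have s2 : ∑ u : α × β × γ, pxz (u.1, u.2.2) * pyz u.2 / pz u.2.2 ≤ 1 := by
    rw [← sum_law P Z]
    have hcomm : ∑ u : α × β × γ, pxz (u.1, u.2.2) * pyz u.2 / pz u.2.2 =
        ∑ z, ∑ y, ∑ x, pxz (x, z) * pyz (y, z) / pz z := by
      simp_rw [Fintype.sum_prod_type]
      rw [Finset.sum_comm]
      rw [Finset.sum_congr rfl fun y _ => Finset.sum_comm]
      exact Finset.sum_comm
    rw [hcomm]
    refine Finset.sum_le_sum fun z _ => ?_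
    have : ∑ y, ∑ x, pxz (x, z) * pyz (y, z) / pz z = pz z * pz z / pz z := by
      simp_rw [← Finset.sum_div, ← Finset.sum_mul, ← Finset.mul_sum]
      rw [sum_law_pair_left P X Z z, sum_law_pair_left P Y Z z]
    rw [this]
    rcases eq_or_ne (pz z) 0 with h | h
    · simp [h, ← hpz]
    · rw [mul_div_assoc, div_self h, mul_one]
  linarith

lemma entropy_unit_pair (Y : Ω → α) :
    entropy q P (fun ω => (Y ω, ())) = entropy q P Y :=
  entropy_eq_of_determines q (fun _ _ _ _ h => by simpa using h) fun _ _ _ _ h => by simpa using h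

lemma entropy_of_subsingleton [Subsingleton α] (Y : Ω → α) : entropy q P Y = 0 := by
  refine le_antisymm ((entropy_le_log_card q P Y).trans ?_) (entropy_nonneg q P Y)
  have : Fintype.card α ≤ 1 := Fintype.card_le_one_iff_subsingleton.2 ‹_›
  interval_cases Fintype.card α <;> simp

/-- Subadditivity of entropy. -/
lemma entropy_pair_le (Y : Ω → α) (Z : Ω → β) :
    entropy q P (fun ω => (Y ω, Z ω)) ≤ entropy q P Y + entropy q P Z := by
  have h := entropy_submodular q P Y Z (fun _ => ())
  rw [entropy_unit_pair, entropy_unit_pair, entropy_of_subsingleton q P (fun _ : Ω => ())] at h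
  have : entropy q P (fun ω => (Y ω, Z ω)) ≤ entropy q P fun ω => (Y ω, Z ω, ()) :=
    Determines.entropy_le q fun _ _ _ _ h => by simpa using h
  linarith

lemma entropy_finset_pi_le {ι : Type*} [DecidableEq ι] {κ : ι → Type*} [∀ i, Fintype (κ i)]
    (Y : ∀ i, Ω → κ i) (s : Finset ι) :
    entropy q P (fun ω (i : {i // i ∈ s}) => Y i.1 ω) ≤ ∑ i ∈ s, entropy q P (Y i) := by
  induction s using Finset.induction_on with
  | empty => simp [entropy_of_subsingleton]
  | insert a s ha ih =>
    rw [Finset.sum_insert ha]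
    refine le_trans ?_ ((entropy_pair_le q P (Y a) _).trans (add_le_add_right ih _))
    refine Determines.entropy_le q fun ω _ ω' _ h => ?_
    rw [Prod.mk.injEq] at h
    funext ⟨i, hi⟩
    rcases Finset.mem_insert.1 hi with rfl | hi'
    · exact h.1
    · exact congrFun h.2 ⟨i, hi'⟩

variable {P} in
lemma condEntropy_eq_zero_of_determines {Y : Ω → α} {Z : Ω → β} (h : Determines P Z Y) :
    condEntropy q P Y Z = 0 := by
  unfold condEntropy
  rw [entropy_eq_of_determines (Y := fun ω => (Y ω, Z ω)) (Z := Z) q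
    (fun ω h1 ω' h2 hz => Prod.ext (h ω h1 ω' h2 hz) hz)
    (fun ω _ ω' _ hz => (Prod.mk.injEq .. ▸ hz).2), sub_self]

/-- The conditional entropy is a sum of nonnegative terms p(y,z) log (p(z)/p(y,z)), so p(y,z) = p(z)
wherever p(y,z) > 0. Two values of `Y` over one z would then exceed the mass p(z). For q ≤ 1 all
entropies degenerate to 0, hence `hq`. -/
lemma determines_of_condEntropy_eq_zero {q : ℕ} (hq : 1 < q) {Y : Ω → α} {Z : Ω → β}
    (h : condEntropy q P Y Z = 0) : Determines P Z Y := by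
  classical
  have hlog : 0 < Real.log q := Real.log_pos (by exact_mod_cast hq)
  unfold condEntropy at h
  have e := entropy_comp_eq_sum q P (fun ω => (Y ω, Z ω)) Prod.snd
  simp only at e
  rw [e, entropy_eq_sum, ← sub_div, div_eq_zero_iff, or_iff_left hlog.ne',
    ← Finset.sum_sub_distrib] at h
  have hnn : ∀ u : α × β, 0 ≤ law P (fun ω => (Y ω, Z ω)) u *
      -Real.log (law P (fun ω => (Y ω, Z ω)) u) -
      law P (fun ω => (Y ω, Z ω)) u * -Real.log (law P Z u.2) := by
    intro u
    rcases (law_nonneg P (fun ω => (Y ω, Z ω)) u).eq_or_lt with h0 | h0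
    · simp [← h0]
    · have := mul_le_mul_of_nonneg_left (Real.log_le_log h0
        (law_le_comp P (fun ω => (Y ω, Z ω)) Prod.snd u)) h0.le
      simp only at this
      linarith
  rw [Finset.sum_eq_zero_iff_of_nonneg fun u _ => hnn u] at h
  have hpos : ∀ u : α × β, 0 < law P (fun ω => (Y ω, Z ω)) u →
      law P (fun ω => (Y ω, Z ω)) u = law P Z u.2 := by
    intro u h0
    have h1 := h u (Finset.mem_univ _)
    rw [← mul_sub, mul_eq_zero, or_iff_right h0.ne'] at h1
    have h2 := law_le_comp P (fun ω => (Y ω, Z ω)) Prod.snd u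
    exact Real.log_injOn_pos h0 (h0.trans_le h2) (by linarith)
  intro ω hω ω' hω' hz
  by_contra hne
  have p1 := law_pos_of_mem_support P (fun ω => (Y ω, Z ω)) hω
  have p2 := law_pos_of_mem_support P (fun ω => (Y ω, Z ω)) hω'
  have q1 := hpos _ p1
  have q2 := sum_law_pair_left P Y Z (Z ω)
  have q3 := Finset.sum_le_sum_of_subset_of_nonneg (f := fun y => law P (fun ω => (Y ω, Z ω)) (y, Z ω))
    (Finset.subset_univ {Y ω, Y ω'}) fun y _ _ => law_nonneg _ _ _
  rw [Finset.sum_pair hne, q2, hz] at q3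
  simp only [hz] at q1 p2 q3 p1
  linarith

/-- Equality case of Gibbs' inequality. Adding r - p, which sums to zero for the product law r,
makes every term nonnegative, and strictness of `log t < t - 1` for t ≠ 1 forces p = r. -/
lemma law_pair_of_mutualInfo_eq_zero {q : ℕ} (hq : 1 < q) {Y : Ω → α} {Z : Ω → β}
    (h : mutualInfo q P Y Z = 0) (y : α) (z : β) :
    law P (fun ω => (Y ω, Z ω)) (y, z) = law P Y y * law P Z z := by
  have hlog : 0 < Real.log q := Real.log_pos (by exact_mod_cast hq)
  unfold mutualInfo at h
  set U : Ω → α × β := fun ω => (Y ω, Z ω) with hU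
  have e1 := entropy_comp_eq_sum q P U Prod.fst
  have e2 := entropy_comp_eq_sum q P U Prod.snd
  simp only [hU] at e1 e2
  rw [e1, e2, entropy_eq_sum q P U, ← add_div, ← sub_div, div_eq_zero_iff, or_iff_left hlog.ne',
    ← Finset.sum_add_distrib, ← Finset.sum_sub_distrib] at h
  set p := law P U with hp
  set r : α × β → ℝ := fun u => law P Y u.1 * law P Z u.2 with hr
  have hterm : ∀ u, 0 ≤ p u * -Real.log (law P Y u.1) + p u * -Real.log (law P Z u.2) -
      p u * -Real.log (p u) + (r u - p u) ∧
      (p u * -Real.log (law P Y u.1) + p u * -Real.log (law P Z u.2) -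
      p u * -Real.log (p u) + (r u - p u) = 0 → p u = r u) := by
    intro u
    have n1 : 0 ≤ r u := mul_nonneg (law_nonneg _ _ _) (law_nonneg _ _ _)
    rcases (law_nonneg P U u).eq_or_lt with h0 | h0
    · rw [← hp] at h0
      rw [← h0]
      simp only [zero_mul, sub_zero, add_zero, zero_add]
      exact ⟨n1, fun h => h.symm⟩
    · rw [← hp] at h0
      have l1 : 0 < law P Y u.1 := h0.trans_le (law_le_comp P U Prod.fst u)
      have l2 : 0 < law P Z u.2 := h0.trans_le (law_le_comp P U Prod.snd u)
      have hr0 : 0 < r u := mul_pos l1 l2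
      have hl : Real.log (r u / p u) =
          Real.log (law P Y u.1) + Real.log (law P Z u.2) - Real.log (p u) := by
        rw [Real.log_div hr0.ne' h0.ne', hr, Real.log_mul l1.ne' l2.ne']
      have heq : p u * -Real.log (law P Y u.1) + p u * -Real.log (law P Z u.2) -
          p u * -Real.log (p u) + (r u - p u) = p u * (r u / p u - 1 - Real.log (r u / p u)) := by
        rw [hl]; field_simp; ring
      rw [heq]
      refine ⟨mul_nonneg h0.le ?_, fun h => ?_⟩
      · have := Real.log_le_sub_one_of_pos (x := r u / p u) (by positivity)
        linarith
      · rw [mul_eq_zero, or_iff_right h0.ne'] at h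
        by_contra hne
        have := Real.log_lt_sub_one_of_pos (x := r u / p u) (by positivity)
          (fun h1 => hne ((div_eq_one_iff_eq h0.ne').1 h1).symm)
        linarith
  have hs : ∑ u, (p u * -Real.log (law P Y u.1) + p u * -Real.log (law P Z u.2) -
      p u * -Real.log (p u) + (r u - p u)) = 0 := by
    rw [Finset.sum_add_distrib, h, Finset.sum_sub_distrib, hp, sum_law, hr,
      Fintype.sum_prod_type]
    simp_rw [← Finset.mul_sum]
    rw [sum_law, ← Finset.sum_mul, sum_law]
    norm_num
  rw [Finset.sum_eq_zero_iff_of_nonneg fun u _ => (hterm u).1] at hs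
  exact (hterm (y, z)).2 (hs _ (Finset.mem_univ _))

lemma mutualInfo_eq_zero_of_law_pair {Y : Ω → α} {Z : Ω → β}
    (h : ∀ y z, law P (fun ω => (Y ω, Z ω)) (y, z) = law P Y y * law P Z z) :
    mutualInfo q P Y Z = 0 := by
  unfold mutualInfo
  set U : Ω → α × β := fun ω => (Y ω, Z ω) with hU
  have e1 := entropy_comp_eq_sum q P U Prod.fst
  have e2 := entropy_comp_eq_sum q P U Prod.snd
  simp only [hU] at e1 e2
  rw [e1, e2, entropy_eq_sum q P U, ← add_div, ← sub_div, ← Finset.sum_add_distrib,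
    ← Finset.sum_sub_distrib, Finset.sum_eq_zero, zero_div]
  rintro ⟨y, z⟩ -
  have hyz := h y z
  change law P U (y, z) * -Real.log (law P Y y) + law P U (y, z) * -Real.log (law P Z z) -
    law P U (y, z) * -Real.log (law P U (y, z)) = 0
  rcases eq_or_ne (law P U (y, z)) 0 with h0 | h0
  · simp [h0]
  · rw [hyz] at h0 ⊢
    rw [Real.log_mul (left_ne_zero_of_mul h0) (right_ne_zero_of_mul h0)]
    ring

/-- Entropy of a family of mutually independent variables. -/
lemma entropy_pi_of_law_eq_prod {ι : Type*} [Fintype ι] [DecidableEq ι] {κ : ι → Type*}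
    [∀ i, Fintype (κ i)] (Y : ∀ i, Ω → κ i)
    (h : ∀ y, law P (fun ω i => Y i ω) y = ∏ i, law P (Y i) (y i)) :
    entropy q P (fun ω i => Y i ω) = ∑ i, entropy q P (Y i) := by
  set U : Ω → ∀ i, κ i := fun ω i => Y i ω with hU
  have e : ∀ i, entropy q P (Y i) =
    (∑ y, law P U y * -Real.log (law P (Y i) (y i))) / Real.log q :=
    fun i => entropy_comp_eq_sum q P U fun y => y i
  simp_rw [e]
  rw [entropy_eq_sum, ← Finset.sum_div, Finset.sum_comm]
  congr 1
  refine Finset.sum_congr rfl fun y _ => ?_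
  rw [← Finset.mul_sum]
  rcases eq_or_ne (law P U y) 0 with h0 | h0
  · simp [h0]
  · rw [h y] at h0 ⊢
    rw [Real.log_prod fun i _ => (Finset.prod_ne_zero_iff.1 h0 i (Finset.mem_univ _)),
      Finset.sum_neg_distrib]

end Entropy

/-! ### Fractional matchings and vertex covers -/

section Duality

variable {V : Type*} [Fintype V] [DecidableEq V]

/-- Linear programming duality for fractional matchings and fractional vertex covers. -/
lemma exists_matching_cover (E : Finset (Finset V)) (hE : E.Nonempty)
    (hne : ∀ e ∈ E, e.Nonempty) :
    ∃ (ν : ℝ) (x : Finset V → ℝ) (D : V → ℝ), 0 < ν ∧ IsFractionalMatching E x ∧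
      ∑ e ∈ E, x e = ν ∧ (∀ v, 0 ≤ D v) ∧ (∀ e ∈ E, 1 ≤ ∑ v ∈ e, D v) ∧ ∑ v, D v = ν := by
  obtain ⟨e₀, he₀⟩ := hE
  obtain ⟨v₀, hv₀⟩ := hne e₀ he₀
  have : Nonempty V := ⟨v₀⟩
  have : Nonempty {e // e ∈ E} := ⟨⟨e₀, he₀⟩⟩
  -- The payoff is the probability that a random vertex drawn from `y` lies in a random hyperedge
  -- drawn from `z`.
  let f : (V → ℝ) → ({e // e ∈ E} → ℝ) → ℝ := fun y z => ∑ e : {e // e ∈ E}, ∑ v ∈ e.1, y v * z e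
  let f' : ({e // e ∈ E} → ℝ) → ((V → ℝ) →ₗ[ℝ] ℝ) := fun z =>
    ∑ e : {e // e ∈ E}, ∑ v ∈ e.1, z e • LinearMap.proj v
  let f'' : (V → ℝ) → (({e // e ∈ E} → ℝ) →ₗ[ℝ] ℝ) := fun y =>
    ∑ e : {e // e ∈ E}, ∑ v ∈ e.1, y v • LinearMap.proj e
  have hf' : ∀ z, (fun y => f y z) = f' z := by
    intro z; funext y; simp [f, f', mul_comm]
  have hf'' : ∀ y, (fun z => f y z) = f'' y := by
    intro y; funext z; simp [f, f'']
  have c1 : ∀ z, Continuous fun y => f y z := fun z => by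
    simp only [f]; fun_prop
  have c2 : ∀ y, Continuous fun z => f y z := fun y => by
    simp only [f]; fun_prop
  -- the maximizing player chooses vertices, hence the sign
  obtain ⟨z, hz, y, hy, hs⟩ := Sion.exists_isSaddlePointOn (X := stdSimplex ℝ {e // e ∈ E})
    (Y := stdSimplex ℝ V) (f := fun z y => f y z)
    ⟨_, single_mem_stdSimplex ℝ ⟨e₀, he₀⟩⟩ (convex_stdSimplex _ _) (isCompact_stdSimplex _ _)
    (fun y _ => (c2 y).lowerSemicontinuous.lowerSemicontinuousOn _)
    (fun y _ => by
      rw [hf'' y]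
      exact ((f'' y).convexOn (convex_stdSimplex _ _)).quasiconvexOn)
    (convex_stdSimplex _ _) ⟨_, single_mem_stdSimplex ℝ v₀⟩ (isCompact_stdSimplex _ _)
    (fun z _ => (c1 z).upperSemicontinuous.upperSemicontinuousOn _)
    (fun z _ => by
      rw [hf' z]
      exact ((f' z).concaveOn (convex_stdSimplex _ _)).quasiconcaveOn)
  -- Pure deviations from the saddle point give the matching constraints here and the cover
  -- constraints in `he`, both scaled by the value.
  have hv : ∀ v, ∑ e ∈ E.attach with v ∈ e.1, z e ≤ f y z := by
    intro v
    have h := hs z hz _ (single_mem_stdSimplex ℝ v)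
    refine le_trans (le_of_eq ?_) h
    simp only [f]
    rw [Finset.sum_filter]
    simp [Pi.single_apply]
  have he : ∀ e ∈ E, f y z ≤ ∑ v ∈ e, y v := by
    intro e he
    have h := hs _ (single_mem_stdSimplex ℝ ⟨e, he⟩) y hy
    refine h.trans (le_of_eq ?_)
    simp only [f]
    rw [Finset.sum_eq_single ⟨e, he⟩]
    · simp
    · intro b _ hb; simp [hb]
    · simp
  -- A hyperedge of positive weight is nonempty, and the value bounds the load of any of its
  -- vertices.
  have hpos : 0 < f y z := by
    obtain ⟨e, -, hez⟩ : ∃ e ∈ Finset.univ, 0 < z e := by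
      by_contra! hcon
      have := Finset.sum_nonpos hcon
      rw [hz.2] at this
      norm_num at this
    obtain ⟨v, hv'⟩ := hne e.1 e.2
    refine lt_of_lt_of_le ?_ (hv v)
    refine hez.trans_le (Finset.single_le_sum (f := z) (fun i _ => hz.1 i) ?_)
    simp [hv']
  refine ⟨(f y z)⁻¹, fun e => if h : e ∈ E then z ⟨e, h⟩ / f y z else 0, fun v => y v / f y z,
    inv_pos.2 hpos, ⟨fun e he => ?_, fun v => ?_⟩, ?_, fun v => div_nonneg (hy.1 v) hpos.le,
    fun e he' => ?_, ?_⟩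
  · simp only [dif_pos he]
    exact div_nonneg (hz.1 _) hpos.le
  · have h1 : ∑ e ∈ E with v ∈ e, (if h : e ∈ E then z ⟨e, h⟩ / f y z else 0) =
        (∑ e ∈ E.attach with v ∈ e.1, z e) / f y z := by
      rw [Finset.sum_filter, Finset.sum_filter, Finset.sum_div, ← Finset.sum_attach]
      refine Finset.sum_congr rfl fun e _ => ?_
      simp [e.2, ite_div]
    rw [h1, div_le_one hpos]
    exact hv v
  · rw [← Finset.sum_attach]
    simp only [Finset.coe_mem, dite_true]
    rw [← Finset.sum_div, ← Finset.univ_eq_attach, hz.2, one_div]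
  · rw [← Finset.sum_div, one_le_div hpos]
    exact he e he'
  · rw [← Finset.sum_div, hy.2, one_div]

/-- Double counting: after exchanging the sums, D v is multiplied by the load of v, which is at most
1. Besides weak duality, this later combines the converse bounds of the single hyperedges. -/
lemma IsFractionalMatching.sum_le {E : Finset (Finset V)} {x : Finset V → ℝ}
    (hx : IsFractionalMatching E x) {D : V → ℝ} (hD : ∀ v, 0 ≤ D v) :
    ∑ e ∈ E, x e * ∑ v ∈ e, D v ≤ ∑ v, D v := by
  have h1 : ∑ e ∈ E, x e * ∑ v ∈ e, D v = ∑ v, (∑ e ∈ E with v ∈ e, x e) * D v := by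
    simp_rw [Finset.mul_sum, Finset.sum_mul, Finset.sum_filter]
    rw [Finset.sum_comm]
    refine Finset.sum_congr rfl fun e _ => ?_
    rw [← Finset.sum_filter]
    simp
  rw [h1]
  refine Finset.sum_le_sum fun v _ => ?_
  exact mul_le_of_le_one_left (hD v) (hx.2 v)

lemma IsFractionalMatching.weight_le {E : Finset (Finset V)} {x : Finset V → ℝ}
    (hx : IsFractionalMatching E x) {D : V → ℝ} (hD : ∀ v, 0 ≤ D v)
    (hE : ∀ e ∈ E, 1 ≤ ∑ v ∈ e, D v) : ∑ e ∈ E, x e ≤ ∑ v, D v :=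
  (Finset.sum_le_sum fun e he => le_mul_of_one_le_right (hx.1 e he) (hE e he)).trans (hx.sum_le hD)

end Duality

/-! ### The two bounds expressed by the hypergraph -/

section Bounds

variable {N M : ℕ} {R : Fin M → Finset (Fin N)} {X T : ℕ}

lemma pos_of_lt_rhoMin (hρ : X + T < rhoMin R) : 0 < M := by
  rcases Nat.eq_zero_or_pos M with rfl | h
  · simp [rhoMin] at hρ
  · exact h

lemma rhoMin_le (m : Fin M) : rhoMin R ≤ (R m).card := ciInf_le' _ m

lemma rhoMin_le_servers (hρ : X + T < rhoMin R) : rhoMin R ≤ N :=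
  (rhoMin_le ⟨0, pos_of_lt_rhoMin hρ⟩).trans (card_finset_fin_le _)

lemma mem_hyperedges {e : Finset (Fin N)} :
    e ∈ hyperedges R X T ↔ ∃ m, e ⊆ R m ∧ e.card + (X + T) = (R m).card := by
  simp [hyperedges]

lemma hyperedges_nonempty (hρ : X + T < rhoMin R) : (hyperedges R X T).Nonempty := by
  have h := hρ.trans_le (rhoMin_le (R := R) ⟨0, pos_of_lt_rhoMin hρ⟩)
  obtain ⟨e, he, hc⟩ := Finset.exists_subset_card_eq
    (s := R ⟨0, pos_of_lt_rhoMin hρ⟩) (n := (R ⟨0, pos_of_lt_rhoMin hρ⟩).card - (X + T)) (by omega)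
  exact ⟨e, mem_hyperedges.2 ⟨_, he, by omega⟩⟩

lemma nonempty_of_mem_hyperedges (hρ : X + T < rhoMin R) {e : Finset (Fin N)}
    (he : e ∈ hyperedges R X T) : e.Nonempty := by
  obtain ⟨m, -, hc⟩ := mem_hyperedges.1 he
  have := hρ.trans_le (rhoMin_le (R := R) m)
  exact Finset.card_pos.1 (by omega)

lemma mem_downloadRegion_iff {D : Fin N → ℝ} :
    D ∈ downloadRegion R X T ↔
      (∀ n, 0 ≤ D n) ∧ ∀ e ∈ hyperedges R X T, 1 ≤ ∑ n ∈ e, D n := by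
  simp only [downloadRegion, Set.mem_ofPred_eq, mem_hyperedges]
  refine and_congr_right fun _ => ⟨?_, ?_⟩
  · rintro h e ⟨m, h1, h2⟩; exact h m e h1 h2
  · intro h m e h1 h2; exact h e ⟨m, h1, h2⟩

/-- Weak duality makes the pair from `exists_matching_cover` optimal on both sides, and positivity
of the common value lets inversion turn the minimum into a maximum. -/
lemma optima (hρ : X + T < rhoMin R) :
    0 < fractionalMatchingNumber (hyperedges R X T) ∧
    IsGreatest (matchingWeights (hyperedges R X T))
      (fractionalMatchingNumber (hyperedges R X T)) ∧
    IsLeast (totalDownloads R X T) (fractionalMatchingNumber (hyperedges R X T)) ∧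
    IsGreatest (converseValues R X T) (converseBound R X T) ∧
    converseBound R X T = (fractionalMatchingNumber (hyperedges R X T))⁻¹ := by
  obtain ⟨ν, x, D, hν, hx, hxν, hD, hED, hDν⟩ := exists_matching_cover (hyperedges R X T)
    (hyperedges_nonempty hρ) fun e he => nonempty_of_mem_hyperedges hρ he
  have hDmem : D ∈ downloadRegion R X T := mem_downloadRegion_iff.2 ⟨hD, hED⟩
  have h1 : IsGreatest (matchingWeights (hyperedges R X T)) ν := by
    refine ⟨⟨x, hx, hxν⟩, ?_⟩
    rintro _ ⟨x', hx', rfl⟩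
    exact (IsFractionalMatching.weight_le hx' hD hED).trans hDν.le
  have hle : ∀ D' ∈ downloadRegion R X T, ν ≤ ∑ n, D' n := by
    intro D' h
    obtain ⟨h1, h2⟩ := mem_downloadRegion_iff.1 h
    exact hxν.ge.trans (hx.weight_le h1 h2)
  have h2 : IsLeast (totalDownloads R X T) ν := by
    refine ⟨⟨D, hDmem, hDν⟩, ?_⟩
    rintro _ ⟨D', hD', rfl⟩
    exact hle D' hD'
  have h3 : IsGreatest (converseValues R X T) ν⁻¹ := by
    refine ⟨⟨D, hDmem, by simp only [hDν]⟩, ?_⟩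
    rintro _ ⟨D', hD', rfl⟩
    exact inv_anti₀ hν (hle D' hD')
  have e1 : fractionalMatchingNumber (hyperedges R X T) = ν := h1.csSup_eq
  have e2 : converseBound R X T = ν⁻¹ := h3.csSup_eq
  rw [e1, e2]
  exact ⟨hν, h1, h2, h3, rfl⟩

lemma bounds_eq_iff (hρ : X + T < rhoMin R) :
    achievabilityBound R X T = converseBound R X T ↔
      fractionalMatchingNumber (hyperedges R X T) = (N : ℝ) / ((rhoMin R : ℝ) - X - T) := by
  rw [(optima hρ).2.2.2.2, achievabilityBound, ← inv_inj, inv_inv, inv_div, eq_comm]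

end Bounds

/-! ### Data processing -/

section MutualInfo

variable {Ω α β γ δ : Type*} [Fintype α] [Fintype β] [Fintype γ] [Fintype δ] (q : ℕ) {P : PMF Ω}

lemma mutualInfo_nonneg (Y : Ω → α) (Z : Ω → β) : 0 ≤ mutualInfo q P Y Z :=
  sub_nonneg.2 (entropy_pair_le q P Y Z)

lemma mutualInfo_comm (Y : Ω → α) (Z : Ω → β) : mutualInfo q P Y Z = mutualInfo q P Z Y := by
  unfold mutualInfo
  rw [add_comm, entropy_eq_of_determines (Y := fun ω => (Y ω, Z ω)) (Z := fun ω => (Z ω, Y ω)) q]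
  · intro ω _ ω' _ h; simp only [Prod.mk.injEq] at h ⊢; exact h.symm
  · intro ω _ ω' _ h; simp only [Prod.mk.injEq] at h ⊢; exact h.symm

lemma mutualInfo_le_of_determines_right (Y : Ω → α) {Z : Ω → β} {Z' : Ω → γ}
    (h : Determines P Z Z') : mutualInfo q P Y Z' ≤ mutualInfo q P Y Z := by
  have h1 := entropy_submodular q P Y Z Z'
  have h2 : entropy q P (fun ω => (Z ω, Z' ω)) ≤ entropy q P Z :=
    Determines.entropy_le q fun ω hω ω' hω' e => Prod.ext e (h ω hω ω' hω' e)
  have h3 : entropy q P (fun ω => (Y ω, Z ω)) ≤ entropy q P (fun ω => (Y ω, Z ω, Z' ω)) :=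
    Determines.entropy_le q fun ω hω ω' hω' e => by
      simp only [Prod.mk.injEq] at e ⊢; exact ⟨e.1, e.2.1⟩
  unfold mutualInfo
  linarith

/-- The data processing inequality. -/
lemma mutualInfo_le_of_determines {Y : Ω → α} {Y' : Ω → β} {Z : Ω → γ} {Z' : Ω → δ}
    (hY : Determines P Y Y') (hZ : Determines P Z Z') :
    mutualInfo q P Y' Z' ≤ mutualInfo q P Y Z := by
  refine (mutualInfo_le_of_determines_right q Y' hZ).trans ?_
  rw [mutualInfo_comm, mutualInfo_comm q Y]
  exact mutualInfo_le_of_determines_right q Z hY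

lemma mutualInfo_eq_zero_of_determines {Y : Ω → α} {Y' : Ω → β} {Z : Ω → γ} {Z' : Ω → δ}
    (hY : Determines P Y Y') (hZ : Determines P Z Z') (h : mutualInfo q P Y Z = 0) :
    mutualInfo q P Y' Z' = 0 :=
  le_antisymm ((mutualInfo_le_of_determines q hY hZ).trans h.le) (mutualInfo_nonneg q _ _)

end MutualInfo

/-! ### The converse -/

namespace Scheme

variable {F : Type} {N M : ℕ} {R : Fin M → Finset (Fin N)} {K : Fin M → ℕ}

/-- The answer of server `n` to the fixed query `x`. -/
def answerTo (s : Scheme F R K) (n : Fin N) (x : s.Query) : s.Ω → s.Answer :=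
  fun ω => s.ans n x (s.storage n ω)

/-- The answers of the servers in `𝒯` to fixed queries. -/
def answersTo (s : Scheme F R K) (𝒯 : Finset (Fin N)) (w : {n // n ∈ 𝒯} → s.Query) :
    s.Ω → ({n // n ∈ 𝒯} → s.Answer) :=
  fun ω n => s.answerTo n.1 (w n) ω

/-- All shares of the messages in `J`. -/
def sharesOf (s : Scheme F R K) (J : Finset (MsgIdx K)) :
    s.Ω → (∀ i : {i // i ∈ J}, {n : Fin N // n ∈ R i.1.1} → s.Share) :=
  fun ω i => s.shares i.1 ω

/-- All shares of the messages in `J`, and the content of the servers in `𝒳`. -/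
def context (s : Scheme F R K) (𝒳 : Finset (Fin N)) (J : Finset (MsgIdx K)) :
    s.Ω → (∀ i : {i // i ∈ J}, {n : Fin N // n ∈ R i.1.1} → s.Share) ×
      ((n : {n : Fin N // n ∈ 𝒳}) → {i : MsgIdx K // n.1 ∈ R i.1} → s.Share) :=
  fun ω => (s.sharesOf J ω, s.storageOn 𝒳 ω)

/-- All queries that are sent. -/
def sentQueries (s : Scheme F R K) : s.Ω → (Fin N → s.Query) := fun ω n => s.sentQuery n ω

lemma shares_eq_of_sharesOf_eq {s : Scheme F R K} {J : Finset (MsgIdx K)} {ω ω' : s.Ω}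
    (h : s.sharesOf J ω = s.sharesOf J ω') {i : MsgIdx K} (hi : i ∈ J) :
    s.shares i ω = s.shares i ω' := congrFun h ⟨i, hi⟩

lemma storage_eq_of_storageOn_eq {s : Scheme F R K} {𝒳 : Finset (Fin N)} {ω ω' : s.Ω}
    (h : s.storageOn 𝒳 ω = s.storageOn 𝒳 ω') {n : Fin N} (hn : n ∈ 𝒳) :
    s.storage n ω = s.storage n ω' := congrFun h ⟨n, hn⟩

variable [Fintype F] {s : Scheme F R K} {X T : ℕ}

namespace IsFeasible

variable (hs : s.IsFeasible X T)
include hs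

lemma determines_message (hq : 1 < Fintype.card F) (i : MsgIdx K) :
    Determines s.P (s.shares i) (s.W i) :=
  determines_of_condEntropy_eq_zero s.P hq (hs.recoverable i)

/-- Additivity of entropy over all messages leaves no slack in the subadditivity bound for one
message against the rest. -/
lemma mutualInfo_shares_eq_zero (i : MsgIdx K) :
    mutualInfo (Fintype.card F) s.P (s.shares i) (s.sharesOf (Finset.univ.erase i)) = 0 := by
  refine le_antisymm ?_ (mutualInfo_nonneg _ _ _)
  have h1 := entropy_finset_pi_le (Fintype.card F) s.P s.shares (Finset.univ.erase i)
  have h2 := hs.entropy_shares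
  rw [← Finset.add_sum_erase _ _ (Finset.mem_univ i)] at h2
  have h3 : entropy (Fintype.card F) s.P (fun ω i => s.shares i ω) ≤
      entropy (Fintype.card F) s.P
        (fun ω => (s.shares i ω, s.sharesOf (Finset.univ.erase i) ω)) := by
    refine Determines.entropy_le _ fun ω _ ω' _ h => ?_
    rw [Prod.mk.injEq] at h
    funext j
    by_cases hj : j = i
    · subst hj; exact h.1
    · exact shares_eq_of_sharesOf_eq h.2 (by simp [hj])
  have h4 : entropy (Fintype.card F) s.P (s.sharesOf (Finset.univ.erase i)) ≤
    ∑ j ∈ Finset.univ.erase i, entropy (Fintype.card F) s.P (s.shares j) := h1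
  unfold mutualInfo
  linarith

/-- A message is independent of the shares of other messages and of `X` storages. -/
lemma entropy_message_context (hq : 1 < Fintype.card F) {𝒳 : Finset (Fin N)} (h𝒳 : 𝒳.card ≤ X)
    {J : Finset (MsgIdx K)} {i : MsgIdx K} (hi : i ∉ J) :
    s.L + entropy (Fintype.card F) s.P (s.context 𝒳 J) ≤
      entropy (Fintype.card F) s.P (fun ω => (s.W i ω, s.context 𝒳 J ω)) := by
  -- The context is a function of `Y`, what 𝒳 knows about message i, and `O`, all shares of the
  -- others. Security handles `Y` (`h1`), independence of the shares handles `O` (`h2`), and the two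
  -- combine in `h3`.
  let Y : s.Ω → ({n : {n // n ∈ R i.1} // n.1 ∈ 𝒳} → s.Share) := fun ω n => s.share i n.1 ω
  let O := s.sharesOf (Finset.univ.erase i)
  have h1 : mutualInfo (Fintype.card F) s.P (s.W i) Y = 0 := by
    rw [mutualInfo_comm]
    refine mutualInfo_eq_zero_of_determines _ (fun ω _ ω' _ h => ?_) (fun ω _ ω' _ h => ?_)
      (hs.secure 𝒳 h𝒳)
    · funext n
      exact congrFun (storage_eq_of_storageOn_eq h n.2) ⟨i, n.1.2⟩
    · exact congrFun h i
  have h2 : mutualInfo (Fintype.card F) s.P (fun ω => (s.W i ω, Y ω)) O = 0 := by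
    refine mutualInfo_eq_zero_of_determines _ (fun ω hω ω' hω' h => ?_) (fun ω _ ω' _ h => h)
      (hs.mutualInfo_shares_eq_zero i)
    refine Prod.ext (hs.determines_message hq i ω hω ω' hω' h) ?_
    funext n
    exact congrFun h n.1
  have h3 : mutualInfo (Fintype.card F) s.P (s.W i) (fun ω => (Y ω, O ω)) = 0 := by
    refine le_antisymm ?_ (mutualInfo_nonneg _ _ _)
    have e1 := entropy_pair_le (Fintype.card F) s.P Y O
    have e2 : entropy (Fintype.card F) s.P (fun ω => ((s.W i ω, Y ω), O ω)) ≤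
        entropy (Fintype.card F) s.P (fun ω => (s.W i ω, (Y ω, O ω))) :=
      Determines.entropy_le _ fun ω _ ω' _ h => by
        simp only [Prod.mk.injEq] at h ⊢; exact ⟨⟨h.1, h.2.1⟩, h.2.2⟩
    unfold mutualInfo at h1 h2 ⊢
    linarith
  have h4 : mutualInfo (Fintype.card F) s.P (s.W i) (s.context 𝒳 J) = 0 := by
    refine mutualInfo_eq_zero_of_determines _ (fun ω _ ω' _ h => h) (fun ω _ ω' _ h => ?_) h3
    rw [Prod.mk.injEq] at h
    have hsh : ∀ j, j ≠ i → s.shares j ω = s.shares j ω' := fun j hj =>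
      shares_eq_of_sharesOf_eq h.2 (by simp [hj])
    refine Prod.ext ?_ ?_
    · funext j
      exact hsh j.1 fun e => hi (e ▸ j.2)
    · funext n j
      obtain ⟨n, hn⟩ := n
      obtain ⟨j, hj⟩ := j
      by_cases hji : j = i
      · subst hji
        exact congrFun h.1 ⟨⟨n, hj⟩, hn⟩
      · exact congrFun (hsh j hji) ⟨n, hj⟩
  unfold mutualInfo at h4
  rw [hs.entropy_message i] at h4
  linarith

/-- The converse bound for one message and for fixed queries that allow it to be decoded. -/
lemma le_entropy_answersTo (hq : 1 < Fintype.card F) {𝒳 𝒯 A : Finset (Fin N)}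
    (h𝒳 : 𝒳.card ≤ X) {J : Finset (MsgIdx K)} {i : MsgIdx K} (hi : i ∉ J)
    (hJ : ∀ j : MsgIdx K, j.1 ≠ i.1 → j ∈ J) (hR : R i.1 ⊆ A ∪ 𝒯 ∪ 𝒳) {v : Fin N → s.Query}
    (hv : Determines s.P (fun ω n => s.answerTo n (v n) ω) (s.W i)) :
    s.L + (entropy (Fintype.card F) s.P
        (fun ω => (s.answersTo 𝒯 (fun n => v n) ω, s.context 𝒳 (insert i J) ω)) -
      entropy (Fintype.card F) s.P (s.context 𝒳 (insert i J))) ≤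
    ∑ n ∈ A, entropy (Fintype.card F) s.P (s.answerTo n (v n)) +
      (entropy (Fintype.card F) s.P
        (fun ω => (s.answersTo 𝒯 (fun n => v n) ω, s.context 𝒳 J ω)) -
      entropy (Fintype.card F) s.P (s.context 𝒳 J)) := by
  set A1 : s.Ω → ({n // n ∈ A} → s.Answer) := s.answersTo A (fun n => v n) with hA1
  set A2 : s.Ω → ({n // n ∈ 𝒯} → s.Answer) := s.answersTo 𝒯 (fun n => v n) with hA2
  set C := s.context 𝒳 J with hC
  set C' := s.context 𝒳 (insert i J) with hC'
  have e1 : entropy (Fintype.card F) s.P (fun ω => (A1 ω, A2 ω, C ω)) ≤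
      ∑ n ∈ A, entropy (Fintype.card F) s.P (s.answerTo n (v n)) +
        entropy (Fintype.card F) s.P (fun ω => (A2 ω, C ω)) :=
    (entropy_pair_le _ s.P A1 fun ω => (A2 ω, C ω)).trans (add_le_add_left
      (entropy_finset_pi_le _ s.P (fun n => s.answerTo n (v n)) A) _)
  -- Decoding needs all N answers. Those in 𝒳 follow from the given contents, and those outside `R
  -- i.1` from the shares in J, which contains every message of the other sets.
  have e2 : entropy (Fintype.card F) s.P (fun ω => (A2 ω, (s.W i ω, C ω))) ≤
      entropy (Fintype.card F) s.P (fun ω => (A1 ω, A2 ω, C ω)) := by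
    refine Determines.entropy_le _ fun ω hω ω' hω' h => ?_
    simp only [Prod.mk.injEq] at h ⊢
    refine ⟨h.2.1, hv ω hω ω' hω' ?_, h.2.2⟩
    have hc := h.2.2
    simp only [hC, context, Prod.mk.injEq] at hc
    funext n
    by_cases hn : n ∈ R i.1
    · have := hR hn
      simp only [Finset.mem_union] at this
      rcases this with (h' | h') | h'
      · exact congrFun h.1 ⟨n, h'⟩
      · exact congrFun h.2.1 ⟨n, h'⟩
      · simp only [answerTo, storage_eq_of_storageOn_eq hc.2 h']
    · have : s.storage n ω = s.storage n ω' := by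
        funext ⟨j, hj⟩
        have hjJ : j ∈ J := hJ j fun e => hn (e ▸ hj)
        exact congrFun (shares_eq_of_sharesOf_eq hc.1 hjJ) ⟨n, hj⟩
      simp only [answerTo, this]
  -- Conditioning also on the shares of message i only lowers the entropy of the answers of 𝒯; since
  -- the shares determine the message, the new conditioning is `C'`.
  have e3 := entropy_submodular (Fintype.card F) s.P A2 (s.shares i) fun ω => (s.W i ω, C ω)
  have e4 : entropy (Fintype.card F) s.P (fun ω => (A2 ω, C' ω)) ≤
      entropy (Fintype.card F) s.P (fun ω => (A2 ω, s.shares i ω, s.W i ω, C ω)) := by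
    refine Determines.entropy_le _ fun ω hω ω' hω' h => ?_
    simp only [Prod.mk.injEq, hC, hC', context] at h ⊢
    refine ⟨h.1, ?_, h.2.2.2.2⟩
    funext ⟨j, hj⟩
    rcases Finset.mem_insert.1 hj with rfl | hj'
    · exact h.2.1
    · exact shares_eq_of_sharesOf_eq h.2.2.2.1 hj'
  have e5 : entropy (Fintype.card F) s.P (fun ω => (s.shares i ω, s.W i ω, C ω)) ≤
      entropy (Fintype.card F) s.P C' := by
    refine Determines.entropy_le _ fun ω hω ω' hω' h => ?_
    simp only [Prod.mk.injEq, hC, hC', context] at h ⊢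
    have h1 := shares_eq_of_sharesOf_eq h.1 (Finset.mem_insert_self i J)
    refine ⟨h1, hs.determines_message hq i ω hω ω' hω' h1, ?_, h.2⟩
    funext ⟨j, hj⟩
    exact shares_eq_of_sharesOf_eq h.1 (Finset.mem_insert_of_mem hj)
  have e6 := hs.entropy_message_context hq h𝒳 hi
  linarith

/-- Queries that are sent with positive probability let the desired message be decoded. -/
lemma determines_of_sentQueries (hq : 1 < Fintype.card F) {v : Fin N → s.Query} {i : MsgIdx K}
    (h : 0 < law s.P (fun ω => (s.sentQueries ω, s.θ ω)) (v, i)) :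
    Determines s.P (fun ω n => s.answerTo n (v n) ω) (s.W i) := by
  obtain ⟨ω₀, hω₀, h₀⟩ := exists_mem_support_of_law_pos _ _ h
  rw [Prod.mk.injEq] at h₀
  -- Contents are independent of index and queries, so each possible content also occurs together
  -- with the index i and the queries v, where correctness applies.
  have lift : ∀ ω ∈ s.P.support, ∃ ω₁ ∈ s.P.support, s.storageOn Finset.univ ω₁ =
      s.storageOn Finset.univ ω ∧ s.θ ω₁ = i ∧ s.sentQueries ω₁ = v := by
    intro ω hω
    have hp := law_pair_of_mutualInfo_eq_zero s.P hq hs.no_prior_knowledge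
      (s.storageOn Finset.univ ω) (s.θ ω₀, fun i n => s.Q n i ω₀)
    have hpos : 0 < law s.P (fun ω => (s.storageOn Finset.univ ω,
        (s.θ ω, fun (i : MsgIdx K) (n : Fin N) => s.Q n i ω)))
        (s.storageOn Finset.univ ω, (s.θ ω₀, fun i n => s.Q n i ω₀)) := by
      rw [hp]
      exact mul_pos (law_pos_of_mem_support _ _ hω) (law_pos_of_mem_support _
        (fun ω => (s.θ ω, fun (i : MsgIdx K) (n : Fin N) => s.Q n i ω)) hω₀)
    obtain ⟨ω₁, hω₁, h₁⟩ := exists_mem_support_of_law_pos _ _ hpos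
    simp only [Prod.mk.injEq] at h₁
    refine ⟨ω₁, hω₁, h₁.1, h₁.2.1.trans h₀.2, ?_⟩
    rw [← h₀.1]
    funext n
    simp only [sentQueries, sentQuery, h₁.2.1]
    exact congrFun (congrFun h₁.2.2 _) n
  intro ω hω ω' hω' hans
  obtain ⟨ω₁, m₁, st₁, th₁, qu₁⟩ := lift ω hω
  obtain ⟨ω₂, m₂, st₂, th₂, qu₂⟩ := lift ω' hω'
  have hW : ∀ ω ∈ s.P.support, ∀ ω₁ ∈ s.P.support, s.storageOn Finset.univ ω₁ =
      s.storageOn Finset.univ ω → s.W i ω = s.W i ω₁ := fun ω hω ω₁ hω₁ e =>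
    hs.determines_message hq i ω hω ω₁ hω₁ (by
      funext n
      exact congrFun (storage_eq_of_storageOn_eq e.symm (Finset.mem_univ n.1)) ⟨i, n.2⟩)
  have ha : ∀ ω ω₁, s.storageOn Finset.univ ω₁ = s.storageOn Finset.univ ω →
      s.sentQueries ω₁ = v → ∀ n, s.answer n ω₁ = s.answerTo n (v n) ω := by
    intro ω ω₁ e1 e2 n
    simp only [answer, answerTo, storage_eq_of_storageOn_eq e1 (Finset.mem_univ n), ← e2]
    rfl
  have hc := determines_of_condEntropy_eq_zero s.P hq hs.correct ω₁ m₁ ω₂ m₂ (by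
    simp only [Prod.mk.injEq]
    refine ⟨?_, qu₁.trans qu₂.symm, th₁.trans th₂.symm⟩
    funext n
    rw [ha ω ω₁ st₁ qu₁, ha ω' ω₂ st₂ qu₂]
    exact congrFun hans n)
  simp only [th₁, th₂] at hc
  rw [hW ω hω ω₁ m₁ st₁, hc, ← hW ω' hω' ω₂ m₂ st₂]

omit hs in
/-- Averaging over the queries sent for message `i` a function of queries that carry no information
about the desired index. -/
lemma sum_law_sentQueries {β : Type*} [Fintype β] (hq : 1 < Fintype.card F)
    (g : (Fin N → s.Query) → β) {Y : s.Ω → β} (hY : Y = fun ω => g (s.sentQueries ω))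
    (h : mutualInfo (Fintype.card F) s.P Y s.θ = 0)
    (φ : β → ℝ) (i : MsgIdx K) :
    ∑ v, law s.P (fun ω => (s.sentQueries ω, s.θ ω)) (v, i) * φ (g v) =
      law s.P s.θ i * ∑ y, law s.P Y y * φ y := by
  classical
  subst hY
  have h1 := sum_law_mul s.P (fun ω => (s.sentQueries ω, s.θ ω)) (fun u => (g u.1, u.2))
    (fun u => if u.2 = i then φ u.1 else 0)
  simp only [Fintype.sum_prod_type, mul_ite, mul_zero, Finset.sum_ite_eq', Finset.mem_univ,
    if_true] at h1
  rw [← h1, Finset.mul_sum]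
  refine Finset.sum_congr rfl fun y _ => ?_
  rw [law_pair_of_mutualInfo_eq_zero s.P hq h]
  ring

lemma mutualInfo_sentQuery (hT : 1 ≤ T) (n : Fin N) :
    mutualInfo (Fintype.card F) s.P (s.sentQuery n) s.θ = 0 :=
  mutualInfo_eq_zero_of_determines _ (Y := s.sentQueryOn {n})
    (fun ω _ ω' _ h => congrFun h ⟨n, Finset.mem_singleton_self n⟩) (fun ω _ ω' _ h => h)
    (hs.isPrivate {n} (by simpa using hT))

/-- The content of a server is independent of the query it receives, so the answer is a mixture over
the queries. -/
lemma law_answer (hq : 1 < Fintype.card F) (n : Fin N) (a : s.Answer) :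
    law s.P (s.answer n) a =
      ∑ x, law s.P (s.sentQuery n) x * law s.P (s.answerTo n x) a := by
  classical
  have h0 : mutualInfo (Fintype.card F) s.P (s.storage n) (s.sentQuery n) = 0 := by
    refine mutualInfo_eq_zero_of_determines _ (fun ω _ ω' _ h => ?_) (fun ω _ ω' _ h => ?_)
      hs.no_prior_knowledge
    · exact storage_eq_of_storageOn_eq h (Finset.mem_univ n)
    · rw [Prod.mk.injEq] at h
      simp only [sentQuery, h.1]
      exact congrFun (congrFun h.2 _) n
  have h1 : law s.P (s.answer n) a = _ :=
    law_comp s.P (fun ω => (s.storage n ω, s.sentQuery n ω)) (fun u => s.ans n u.2 u.1) a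
  rw [h1, Fintype.sum_prod_type, Finset.sum_comm]
  refine Finset.sum_congr rfl fun x _ => ?_
  have h2 : law s.P (s.answerTo n x) a = _ := law_comp s.P (s.storage n) (fun u => s.ans n x u) a
  rw [h2, Finset.mul_sum]
  refine Finset.sum_congr rfl fun y _ => ?_
  simp only [law_pair_of_mutualInfo_eq_zero s.P hq h0]
  split_ifs <;> ring

/-- Jensen for the concave `Real.negMulLog` on this mixture: conditioning on the query reduces
entropy. -/
lemma sum_entropy_answerTo_le (hq : 1 < Fintype.card F) (n : Fin N) :
    ∑ x, law s.P (s.sentQuery n) x * entropy (Fintype.card F) s.P (s.answerTo n x) ≤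
      entropy (Fintype.card F) s.P (s.answer n) := by
  have e : ∀ Y : s.Ω → s.Answer, entropy (Fintype.card F) s.P Y =
    ∑ a, Real.negMulLog (law s.P Y a) / Real.log (Fintype.card F) := fun _ => rfl
  simp_rw [e, Finset.mul_sum]
  rw [Finset.sum_comm]
  refine Finset.sum_le_sum fun a _ => ?_
  simp_rw [← mul_div_assoc]
  rw [← Finset.sum_div, hs.law_answer hq]
  refine div_le_div_of_nonneg_right ?_ (Real.log_natCast_nonneg _)
  have := Real.concaveOn_negMulLog.le_map_sum (t := Finset.univ)
    (w := fun x => law s.P (s.sentQuery n) x) (p := fun x => law s.P (s.answerTo n x) a)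
    (fun x _ => law_nonneg _ _ _) (sum_law _ _) (fun x _ => law_nonneg _ _ _)
  simpa only [smul_eq_mul] using this

end IsFeasible

/-- The entropy of the answers of `𝒯` to fixed queries, conditioned on the shares of the messages
in `J` and on the content of the servers in `𝒳`. -/
noncomputable def answersEntropy (s : Scheme F R K) (𝒳 𝒯 : Finset (Fin N)) (J : Finset (MsgIdx K))
    (w : {n // n ∈ 𝒯} → s.Query) : ℝ :=
  entropy (Fintype.card F) s.P (fun ω => (s.answersTo 𝒯 w ω, s.context 𝒳 J ω)) -
    entropy (Fintype.card F) s.P (s.context 𝒳 J)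

/-- The average over the queries to `𝒯` of the entropy of the answers of `𝒯`, conditioned on the
queries, on the shares of the messages in `J` and on the content of the servers in `𝒳`. -/
noncomputable def residual (s : Scheme F R K) (𝒳 𝒯 : Finset (Fin N)) (J : Finset (MsgIdx K)) : ℝ :=
  ∑ w, law s.P (s.sentQueryOn 𝒯) w * s.answersEntropy 𝒳 𝒯 J w

lemma residual_nonneg (s : Scheme F R K) (𝒳 𝒯 : Finset (Fin N)) (J : Finset (MsgIdx K)) :
    0 ≤ s.residual 𝒳 𝒯 J := by
  refine Finset.sum_nonneg fun w _ => mul_nonneg (law_nonneg _ _ _) (sub_nonneg.2 ?_)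
  exact Determines.entropy_le _ fun ω _ ω' _ h => (Prod.mk.injEq .. ▸ h).2

namespace IsFeasible

variable (hs : s.IsFeasible X T)
include hs

lemma residual_le (hq : 1 < Fintype.card F) (𝒳 𝒯 : Finset (Fin N)) (J : Finset (MsgIdx K)) :
    s.residual 𝒳 𝒯 J ≤ ∑ n ∈ 𝒯, entropy (Fintype.card F) s.P (s.answer n) := by
  have h1 : s.residual 𝒳 𝒯 J ≤ ∑ w, law s.P (s.sentQueryOn 𝒯) w *
      ∑ n : {n // n ∈ 𝒯}, entropy (Fintype.card F) s.P (s.answerTo n.1 (w n)) := by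
    refine Finset.sum_le_sum fun w _ => mul_le_mul_of_nonneg_left ?_ (law_nonneg _ _ _)
    unfold answersEntropy
    have e1 := entropy_pair_le (Fintype.card F) s.P (s.answersTo 𝒯 w) (s.context 𝒳 J)
    have e2 := entropy_finset_pi_le (Fintype.card F) s.P
      (fun (n : {n // n ∈ 𝒯}) => s.answerTo n.1 (w n)) Finset.univ
    have e3 : entropy (Fintype.card F) s.P (s.answersTo 𝒯 w) ≤ _ :=
      (Determines.entropy_le _ fun ω _ ω' _ h => by
        funext n; exact congrFun h ⟨n, Finset.mem_univ n⟩).trans e2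
    linarith
  refine h1.trans ?_
  simp_rw [Finset.mul_sum]
  rw [Finset.sum_comm, ← Finset.sum_coe_sort 𝒯]
  refine Finset.sum_le_sum fun n _ => (le_of_eq ?_).trans (hs.sum_entropy_answerTo_le hq n.1)
  exact (sum_law_mul s.P (s.sentQueryOn 𝒯) (fun w => w n)
    (fun x => entropy (Fintype.card F) s.P (s.answerTo n.1 x))).symm

/-- Average `le_entropy_answersTo` over the queries sent for message i. Privacy for 𝒯 makes the
averages residuals that do not depend on i, which permits telescoping; privacy for single servers,
where `hT` enters, does the same for the answers of A. -/
lemma residual_insert (hq : 1 < Fintype.card F) (hT : 1 ≤ T) {𝒳 𝒯 A : Finset (Fin N)}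
    (h𝒳 : 𝒳.card ≤ X) (h𝒯 : 𝒯.card ≤ T) {J : Finset (MsgIdx K)} {i : MsgIdx K} (hi : i ∉ J)
    (hJ : ∀ j : MsgIdx K, j.1 ≠ i.1 → j ∈ J) (hR : R i.1 ⊆ A ∪ 𝒯 ∪ 𝒳) :
    s.L + s.residual 𝒳 𝒯 (insert i J) ≤
      ∑ n ∈ A, entropy (Fintype.card F) s.P (s.answer n) + s.residual 𝒳 𝒯 J := by
  obtain ⟨p, hp⟩ : ∃ p, p = law s.P (fun ω => (s.sentQueries ω, s.θ ω)) := ⟨_, rfl⟩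
  obtain ⟨c, hc⟩ : ∃ c, c = law s.P s.θ i := ⟨_, rfl⟩
  have hMK : 0 < (M : ℝ) * K i.1 := by
    have h1 : 0 < M := i.1.pos
    have h2 : 0 < K i.1 := i.2.pos
    positivity
  have hcpos : 0 < c := by
    rw [hc, law, hs.uniform_index]; positivity
  have hterm : ∀ v, p (v, i) * (s.L + s.answersEntropy 𝒳 𝒯 (insert i J) (fun n => v n)) ≤
      p (v, i) * (∑ n ∈ A, entropy (Fintype.card F) s.P (s.answerTo n (v n)) +
        s.answersEntropy 𝒳 𝒯 J (fun n => v n)) := by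
    intro v
    rcases (law_nonneg s.P (fun ω => (s.sentQueries ω, s.θ ω)) (v, i)).eq_or_lt with h0 | h0
    · rw [hp, ← h0, zero_mul, zero_mul]
    · rw [hp]
      exact mul_le_mul_of_nonneg_left (hs.le_entropy_answersTo hq h𝒳 hi hJ hR
        (hs.determines_of_sentQueries hq h0)) h0.le
  have hsum := Finset.sum_le_sum fun v (_ : v ∈ Finset.univ) => hterm v
  simp_rw [mul_add, Finset.sum_add_distrib, Finset.mul_sum] at hsum
  have hres : ∀ J : Finset (MsgIdx K), ∑ v, p (v, i) *
      s.answersEntropy 𝒳 𝒯 J (fun n => v n) = c * s.residual 𝒳 𝒯 J := by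
    intro J
    rw [hp, hc, residual]
    exact sum_law_sentQueries (s := s) hq (fun v (n : {n // n ∈ 𝒯}) => v n) rfl (hs.isPrivate 𝒯 h𝒯)
      (s.answersEntropy 𝒳 𝒯 J) i
  have hL : ∑ v, p (v, i) * (s.L : ℝ) = c * s.L := by
    rw [← Finset.sum_mul, hp, hc, sum_law_pair_left s.P s.sentQueries s.θ i]
  have hans : ∑ v, ∑ n ∈ A, p (v, i) * entropy (Fintype.card F) s.P (s.answerTo n (v n)) ≤
      c * ∑ n ∈ A, entropy (Fintype.card F) s.P (s.answer n) := by
    rw [Finset.sum_comm, Finset.mul_sum]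
    refine Finset.sum_le_sum fun n _ => ?_
    rw [hp, hc]
    have h1 := sum_law_sentQueries (s := s) hq (fun v => v n) rfl (hs.mutualInfo_sentQuery hT n)
      (fun x => entropy (Fintype.card F) s.P (s.answerTo n x)) i
    exact h1.le.trans (mul_le_mul_of_nonneg_left (hs.sum_entropy_answerTo_le hq n)
      (law_nonneg _ _ _))
  rw [hL, hres, hres] at hsum
  refine le_of_mul_le_mul_left ?_ hcpos
  linarith

/-- The converse bound for one hyperedge. -/
lemma converse_hyperedge (hq : 1 < Fintype.card F) (hT : 1 ≤ T) (m : Fin M)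
    {𝒳 𝒯 A : Finset (Fin N)} (h𝒳 : 𝒳.card ≤ X) (h𝒯 : 𝒯.card ≤ T) (hR : R m ⊆ A ∪ 𝒯 ∪ 𝒳) :
    (K m : ℝ) * s.L ≤ K m * ∑ n ∈ A, entropy (Fintype.card F) s.P (s.answer n) +
      ∑ n ∈ 𝒯, entropy (Fintype.card F) s.P (s.answer n) := by
  -- All messages of the other sets and the first c messages of set m; c grows from 0 to `K m`.
  let J : ℕ → Finset (MsgIdx K) := fun c => Finset.univ.filter fun j => j.1 = m → j.2.val < c
  have key : ∀ c ≤ K m, (c : ℝ) * s.L + s.residual 𝒳 𝒯 (J c) ≤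
      c * ∑ n ∈ A, entropy (Fintype.card F) s.P (s.answer n) + s.residual 𝒳 𝒯 (J 0) := by
    intro c
    induction c with
    | zero => simp
    | succ c ih =>
      intro hc
      have h1 := ih (by omega)
      let i : MsgIdx K := ⟨m, ⟨c, hc⟩⟩
      have hins : J (c + 1) = insert i (J c) := by
        ext ⟨m', k⟩
        simp only [J, Finset.mem_filter, Finset.mem_univ, true_and, Finset.mem_insert, i]
        by_cases hm : m' = m
        · subst hm
          simp [Fin.ext_iff]
          omega
        · simp [hm]
      have h2 := hs.residual_insert hq hT h𝒳 h𝒯 (J := J c) (i := i) (A := A) (𝒯 := 𝒯)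
        (by simp [J, i]) (fun j hj => by simp only [J, Finset.mem_filter, Finset.mem_univ, true_and]
                                         exact fun h => absurd h hj) hR
      rw [hins]
      push_cast
      linarith
  have h1 := key (K m) le_rfl
  have h2 := s.residual_nonneg 𝒳 𝒯 (J (K m))
  have h3 := hs.residual_le hq 𝒳 𝒯 (J 0)
  linarith

/-- Each hyperedge downloads at least L - D/k; weighting by an optimal matching gives ν(L - D/k) ≤
D. -/
lemma le_download (hq : 1 < Fintype.card F) (hT : 1 ≤ T) (hρ : X + T < rhoMin R) {k : ℕ}
    (hk : 0 < k) (hK : ∀ m, k ≤ K m) :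
    fractionalMatchingNumber (hyperedges R X T) * s.L ≤
      s.download * (1 + fractionalMatchingNumber (hyperedges R X T) / k) := by
  set ν := fractionalMatchingNumber (hyperedges R X T) with hν
  obtain ⟨x, hx, hxν⟩ := (optima hρ).2.1.1
  rw [← hν] at hxν
  simp only at hxν
  set H : Fin N → ℝ := fun n => entropy (Fintype.card F) s.P (s.answer n) with hH
  have hH0 : ∀ n, 0 ≤ H n := fun n => entropy_nonneg _ _ _
  have hD0 : 0 ≤ s.download := Finset.sum_nonneg fun n _ => hH0 n
  have hedge : ∀ e ∈ hyperedges R X T, (s.L : ℝ) - s.download / k ≤ ∑ n ∈ e, H n := by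
    intro e he
    obtain ⟨m, hem, hc⟩ := mem_hyperedges.1 he
    have hcard := Finset.card_sdiff_of_subset hem
    -- The X + T servers of `R m` outside e are split into X whose content is revealed and T that
    -- are covered by privacy.
    obtain ⟨𝒳, h𝒳, hc𝒳⟩ := Finset.exists_subset_card_eq (s := R m \ e) (n := X) (by omega)
    have hc𝒯 := Finset.card_sdiff_of_subset h𝒳
    have h1 := hs.converse_hyperedge hq hT m (𝒳 := 𝒳) (𝒯 := (R m \ e) \ 𝒳) (A := e) hc𝒳.le
      (by omega) (by
        intro n hn
        simp only [Finset.mem_union, Finset.mem_sdiff]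
        tauto)
    have h2 : ∑ n ∈ (R m \ e) \ 𝒳, H n ≤ s.download :=
      Finset.sum_le_sum_of_subset_of_nonneg (Finset.subset_univ _) fun n _ _ => hH0 n
    have hKm : (k : ℝ) ≤ K m := by exact_mod_cast hK m
    have hk' : (0 : ℝ) < k := by exact_mod_cast hk
    have hKpos : (0 : ℝ) < K m := hk'.trans_le hKm
    have h3 : s.download / K m ≤ s.download / k := div_le_div_of_nonneg_left hD0 hk' hKm
    have h4 : (s.L : ℝ) - s.download / K m ≤ ∑ n ∈ e, H n := by
      rw [sub_le_iff_le_add, ← mul_le_mul_iff_right₀ hKpos, mul_add, mul_div_cancel₀ _ hKpos.ne']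
      linarith
    linarith
  have h5 := hx.sum_le hH0
  have h6 : ∑ e ∈ hyperedges R X T, x e * ((s.L : ℝ) - s.download / k) ≤
      ∑ e ∈ hyperedges R X T, x e * ∑ n ∈ e, H n :=
    Finset.sum_le_sum fun e he => mul_le_mul_of_nonneg_left (hedge e he) (hx.1 e he)
  rw [← Finset.sum_mul, hxν] at h6
  have h7 : ∑ n, H n = s.download := rfl
  rw [h7] at h5
  have : s.download * (1 + ν / k) = s.download + ν * (s.download / k) := by ring
  rw [this]
  linarith

end IsFeasible

end Scheme

/-- The converse for finitely many messages. -/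
lemma capacity_le {F : Type} [Fintype F] (hq : 1 < Fintype.card F) {N M : ℕ}
    {R : Fin M → Finset (Fin N)} {X T : ℕ} (hT : 1 ≤ T) (hρ : X + T < rhoMin R)
    {K : Fin M → ℕ} {k : ℕ} (hk : 0 < k) (hK : ∀ m, k ≤ K m) :
    capacity F R X T K ≤
      ENNReal.ofReal ((fractionalMatchingNumber (hyperedges R X T))⁻¹ + (k : ℝ)⁻¹) := by
  refine iSup₂_le fun s hs => ?_
  have h := hs.le_download hq hT hρ hk hK
  have hν := (optima hρ).1
  set ν := fractionalMatchingNumber (hyperedges R X T)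
  have hk' : (0 : ℝ) < k := by exact_mod_cast hk
  have hL : (0 : ℝ) < s.L := by exact_mod_cast hs.L_pos
  have hD : 0 < s.download := by
    by_contra! hcon
    have h1 : 0 < ν * s.L := by positivity
    have h2 : s.download * (1 + ν / k) ≤ 0 :=
      mul_nonpos_of_nonpos_of_nonneg hcon (by positivity)
    linarith
  rw [Scheme.rate, ← ENNReal.ofReal_natCast s.L, ← ENNReal.ofReal_div_of_pos hD]
  refine ENNReal.ofReal_le_ofReal ?_
  rw [div_le_iff₀ hD]
  refine le_of_mul_le_mul_left (h.trans (le_of_eq ?_)) hν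
  field_simp

/-! ### Independence under uniform sampling -/

section Uniform

variable {Ω A B α β : Type*} [Fintype Ω] [Nonempty Ω] [Fintype A] [Nonempty A] [Fintype B]
  [Nonempty B]

lemma law_uniform [DecidableEq α] (Y : Ω → α) (y : α) :
    law (PMF.uniformOfFintype Ω) Y y =
      ((Finset.univ.filter fun ω => Y ω = y).card : ℝ) / Fintype.card Ω := by
  unfold law
  rw [PMF.map_apply, tsum_fintype]
  simp only [PMF.uniformOfFintype_apply]
  rw [← Finset.sum_filter, Finset.sum_const, nsmul_eq_mul, ENNReal.toReal_mul]
  simp only [eq_comm (a := y), ENNReal.toReal_natCast, ENNReal.toReal_inv]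
  rfl

lemma law_uniform_pair (e : Ω ≃ A × B) (f : A → α) (g : B → β) (y : α) (z : β) :
    law (PMF.uniformOfFintype Ω) (fun ω => (f (e ω).1, g (e ω).2)) (y, z) =
      law (PMF.uniformOfFintype A) f y * law (PMF.uniformOfFintype B) g z := by
  classical
  rw [law_uniform, law_uniform, law_uniform]
  have h1 : (Finset.univ.filter fun ω => (f (e ω).1, g (e ω).2) = (y, z)).card =
      (Finset.univ.filter fun a => f a = y).card * (Finset.univ.filter fun b => g b = z).card := by
    rw [← Finset.card_product]
    refine Finset.card_equiv e fun ω => ?_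
    simp
  rw [h1, Fintype.card_congr e, Fintype.card_prod]
  push_cast
  rw [div_mul_div_comm]

lemma law_uniform_fst (e : Ω ≃ A × B) (f : A → α) (y : α) :
    law (PMF.uniformOfFintype Ω) (fun ω => f (e ω).1) y =
      law (PMF.uniformOfFintype A) f y := by
  classical
  have h := law_uniform_pair e f (fun _ => ()) y ()
  have h1 : law (PMF.uniformOfFintype B) (fun _ => ()) () = 1 := by
    simpa using sum_law (PMF.uniformOfFintype B) (fun _ => ())
  rw [h1, mul_one] at h
  rw [← h, law_uniform, law_uniform]
  simp

lemma law_uniform_snd (e : Ω ≃ A × B) (g : B → β) (z : β) :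
    law (PMF.uniformOfFintype Ω) (fun ω => g (e ω).2) z =
      law (PMF.uniformOfFintype B) g z :=
  law_uniform_fst (e.trans (Equiv.prodComm A B)) g z

lemma law_uniform_id (a : A) :
    law (PMF.uniformOfFintype A) (fun a => a) a = (Fintype.card A : ℝ)⁻¹ := by
  classical
  have h : (Finset.univ.filter fun x : A => x = a) = {a} := by ext; simp
  rw [law_uniform, h, Finset.card_singleton, Nat.cast_one, one_div]

lemma law_uniform_pi {ι : Type*} [Fintype ι] [DecidableEq ι] {κ : ι → Type*}
    (f : ∀ i, A → κ i) (y : ∀ i, κ i) :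
    law (PMF.uniformOfFintype (ι → A)) (fun a i => f i (a i)) y =
      ∏ i, law (PMF.uniformOfFintype A) (f i) (y i) := by
  classical
  simp_rw [law_uniform]
  have h1 : (Finset.univ.filter fun a : ι → A => (fun i => f i (a i)) = y) =
      Fintype.piFinset fun i => Finset.univ.filter fun x => f i x = y i := by
    ext a; simp [funext_iff]
  rw [h1, Fintype.card_piFinset, Finset.prod_div_distrib, Fintype.card_fun]
  simp

/-- Independence is certified by a bijection onto a product through whose separate factors the two
variables pass; security, privacy and absence of prior knowledge are all proved this way. -/
lemma mutualInfo_uniform_eq_zero [Fintype α] [Fintype β] (q : ℕ) (e : Ω ≃ A × B)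
    {Y : Ω → α} {Z : Ω → β} (f : A → α) (g : B → β) (hY : ∀ ω, Y ω = f (e ω).1)
    (hZ : ∀ ω, Z ω = g (e ω).2) : mutualInfo q (PMF.uniformOfFintype Ω) Y Z = 0 := by
  obtain rfl : Y = fun ω => f (e ω).1 := funext hY
  obtain rfl : Z = fun ω => g (e ω).2 := funext hZ
  refine mutualInfo_eq_zero_of_law_pair _ _ fun y z => ?_
  rw [law_uniform_pair, law_uniform_fst, law_uniform_snd]

lemma entropy_uniform_fst [Fintype α] (q : ℕ) (e : Ω ≃ α × B) [Nonempty α] {Y : Ω → α}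
    (hY : ∀ ω, Y ω = (e ω).1) :
    entropy q (PMF.uniformOfFintype Ω) Y = Real.log (Fintype.card α) / Real.log q := by
  obtain rfl : Y = fun ω => (e ω).1 := funext hY
  refine entropy_of_uniform _ _ _ fun y => ?_
  rw [law_uniform_fst e (fun a => a), law_uniform_id]

lemma entropy_uniform_pi {ι : Type*} [Fintype ι] [DecidableEq ι] {κ : ι → Type*}
    [∀ i, Fintype (κ i)] (q : ℕ) (e : Ω ≃ (ι → A) × B) {Y : ∀ i, Ω → κ i} (f : ∀ i, A → κ i)
    (hY : ∀ i ω, Y i ω = f i ((e ω).1 i)) :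
    entropy q (PMF.uniformOfFintype Ω) (fun ω i => Y i ω) =
      ∑ i, entropy q (PMF.uniformOfFintype Ω) (Y i) := by
  obtain rfl : Y = fun i ω => f i ((e ω).1 i) := funext fun i => funext fun ω => hY i ω
  refine entropy_pi_of_law_eq_prod _ _ _ fun y => ?_
  rw [law_uniform_fst e (fun a i => f i (a i)), law_uniform_pi]
  refine Finset.prod_congr rfl fun i _ => ?_
  rw [law_uniform_fst e (fun a => f i (a i))]
  exact (law_uniform_fst (Equiv.funSplitAt i A) (f i) (y i)).symm

/-- Translation of the first of two coordinates by a function of the second one. -/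
def shearEquiv {G : Type*} [AddGroup G] (t : B → G) : G × B ≃ G × B where
  toFun u := (u.1 + t u.2, u.2)
  invFun u := (u.1 - t u.2, u.2)
  left_inv u := by simp
  right_inv u := by simp

end Uniform

/-! ### Noise polynomials and barycentric interpolation -/

section Interpolation

open Polynomial

variable {𝕂 : Type*} [Field 𝕂]

/-- The value at `x` of the polynomial with coefficients `a`. -/
def polyValue {k : ℕ} (a : Fin k → 𝕂) (x : 𝕂) : 𝕂 := ∑ t, a t * x ^ (t : ℕ)

lemma polyValue_add {k : ℕ} (a b : Fin k → 𝕂) (x : 𝕂) :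
    polyValue (a + b) x = polyValue a x + polyValue b x := by
  simp [polyValue, add_mul, Finset.sum_add_distrib]

/-- With k coefficients the values at up to k points are arbitrary, so a shift of the noise can
absorb whatever those servers would learn. -/
lemma exists_polyValue_eq {ι : Type*} [DecidableEq ι] {k : ℕ} {s : Finset ι} (hs : s.card ≤ k)
    {α : ι → 𝕂} (hα : Set.InjOn α s) (r : ι → 𝕂) :
    ∃ a : Fin k → 𝕂, ∀ n ∈ s, polyValue a (α n) = r n := by
  rcases Nat.eq_zero_or_pos k with rfl | hk
  · have : s = ∅ := Finset.card_eq_zero.1 (by omega)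
    exact ⟨0, by simp [this]⟩
  · refine ⟨fun t => (Lagrange.interpolate s α r).coeff t, fun n hn => ?_⟩
    have hdeg : (Lagrange.interpolate s α r).natDegree < k := by
      by_cases h0 : Lagrange.interpolate s α r = 0
      · simpa [h0] using hk
      · rw [natDegree_lt_iff_degree_lt h0]
        exact (Lagrange.degree_interpolate_lt r hα).trans_le (by exact_mod_cast hs)
    have h := eval_eq_sum_range' hdeg (α n)
    rw [Lagrange.eval_interpolate_at_node r hα hn] at h
    rw [h, polyValue, Finset.sum_range]

/-- Times f - x, the summand without its weight is a polynomial in x of degree at most j + k₁ + k₂ <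
|s|. The barycentric formula evaluates it at the pole f, where both noise terms vanish. -/
lemma sum_nodalWeight_mul {ι : Type*} [DecidableEq ι] {s : Finset ι} {α : ι → 𝕂}
    (hα : Set.InjOn α s) {f : 𝕂} (hf : ∀ n ∈ s, f ≠ α n) {j k₁ k₂ : ℕ}
    (hk : j + k₁ + k₂ < s.card) (δ c : 𝕂) (z : Fin k₁ → 𝕂) (p : Fin k₂ → 𝕂) :
    ∑ n ∈ s, Lagrange.nodalWeight s α n * (α n ^ j * ((δ * (f - α n)⁻¹ + polyValue z (α n)) *
      (c + (f - α n) * polyValue p (α n)))) = δ * c * f ^ j * (eval f (Lagrange.nodal s α))⁻¹ := by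
  have hterm : ∀ {k : ℕ} (b : 𝕂) (a : Fin k → 𝕂), ∃ g : 𝕂[X], g.natDegree ≤ k ∧
      ∀ x, eval x g = b + (f - x) * polyValue a x := by
    intro k b a
    refine ⟨C b + ∑ t : Fin k, (C f - X) * (C (a t) * X ^ (t : ℕ)), ?_, fun x => ?_⟩
    · refine natDegree_add_le_of_degree_le (by simp) (natDegree_sum_le_of_forall_le _ _ ?_)
      intro t _
      have h1 : (C f - X : 𝕂[X]).natDegree ≤ 1 := by
        refine (natDegree_sub_le _ _).trans ?_
        simp
      have h2 := natDegree_C_mul_X_pow_le (a t) (t : ℕ)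
      have h3 := natDegree_mul_le (p := (C f - X : 𝕂[X])) (q := C (a t) * X ^ (t : ℕ))
      have := t.2
      omega
    · simp [eval_finsetSum, polyValue, Finset.mul_sum]
  obtain ⟨g₁, hd₁, hg₁⟩ := hterm δ z
  obtain ⟨g₂, hd₂, hg₂⟩ := hterm c p
  have hdeg : (X ^ j * g₁ * g₂).degree < (s.card : WithBot ℕ) := by
    have h1 := natDegree_mul_le (p := X ^ j * g₁) (q := g₂)
    have h2 := natDegree_mul_le (p := (X ^ j : 𝕂[X])) (q := g₁)
    have h3 := natDegree_X_pow_le (R := 𝕂) j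
    have h4 : (X ^ j * g₁ * g₂).natDegree < s.card := by omega
    exact degree_le_natDegree.trans_lt (by exact_mod_cast h4)
  have h := Lagrange.eval_interpolate_not_at_node (s := s) (v := α) (x := f)
    (fun i => (X ^ j * g₁ * g₂).eval (α i)) hf
  rw [← Lagrange.eq_interpolate hα hdeg] at h
  have hn := Lagrange.eval_nodal_not_at_node hf
  have hl : eval f (X ^ j * g₁ * g₂) = δ * c * f ^ j := by
    simp only [eval_mul, eval_pow, eval_X, hg₁, hg₂]
    ring
  rw [hl] at h
  rw [h, mul_comm, ← mul_assoc, inv_mul_cancel₀ hn, one_mul]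
  refine Finset.sum_congr rfl fun n hns => ?_
  have hne : f - α n ≠ 0 := sub_ne_zero.2 (hf n hns)
  simp only [eval_mul, eval_pow, eval_X, hg₁, hg₂]
  field_simp

end Interpolation

/-! ### The scheme of cross-subspace alignment -/

section CrossSubspaceAlignment

variable {F : Type} [Fintype F] [Nonempty F] {N M : ℕ} [NeZero M]
  {R : Fin M → Finset (Fin N)} {K : Fin M → ℕ} [∀ m, NeZero (K m)] {X T L l : ℕ}
  {𝕂 : Type} [Field 𝕂] [Fintype 𝕂]

/-- The messages with the noise that protects them, the noise that protects the queries, and the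
sources of the desired index. -/
abbrev Sample (F : Type) {M : ℕ} (K : Fin M → ℕ) (X T L l : ℕ) (𝕂 : Type) : Type :=
  (MsgIdx K → (Fin L → F) × (Fin l → Fin X → 𝕂)) ×
    ((MsgIdx K → Fin l → Fin T → 𝕂) × (Fin M × ∀ m, Fin (K m)))

instance : Nonempty (Sample F K X T L l 𝕂) :=
  ⟨(fun _ => (fun _ => Classical.arbitrary F, fun _ _ => 0),
    (fun _ _ _ => 0, (Classical.arbitrary (Fin M), fun _ => 0)))⟩

/-- The scheme of cross-subspace alignment with dual generalized Reed-Solomon weights. The storage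
of server `n` is evaluated at `α n`, and the symbols of a message are placed at the poles `f`. -/
noncomputable def csaScheme (R : Fin M → Finset (Fin N)) (K : Fin M → ℕ) [∀ m, NeZero (K m)]
    (X T : ℕ) (c : (Fin L → F) ≃ (Fin l → 𝕂)) (α : Fin N → 𝕂) (f : Fin l → 𝕂) :
    Scheme F R K where
  Ω := Sample F K X T L l 𝕂
  P := PMF.uniformOfFintype (Sample F K X T L l 𝕂)
  L := L
  Share := Fin l → 𝕂
  Query := MsgIdx K → Fin l → 𝕂
  Answer := 𝕂
  W i ω := (ω.1 i).1
  share i n ω := fun b => c (ω.1 i).1 b + (f b - α n) * polyValue ((ω.1 i).2 b) (α n)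
  θ ω := ⟨ω.2.2.1, ω.2.2.2 ω.2.2.1⟩
  Q n i ω := fun j b => (if j = i then 1 else 0) * (f b - α n)⁻¹ + polyValue (ω.2.1 j b) (α n)
  ans n x S := ∑ i : {i : MsgIdx K // n ∈ R i.1},
    Lagrange.nodalWeight (R i.1.1) α n * ∑ b, x i.1 b * S i b

/-- The index of the desired message. -/
def csaIndex (ω : Sample F K X T L l 𝕂) : MsgIdx K := ⟨ω.2.2.1, ω.2.2.2 ω.2.2.1⟩

/-- The answers of `csaScheme`. -/
noncomputable def csaAnswer (R : Fin M → Finset (Fin N)) (c : (Fin L → F) ≃ (Fin l → 𝕂))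
    (α : Fin N → 𝕂) (f : Fin l → 𝕂) (ω : Sample F K X T L l 𝕂) (n : Fin N) : 𝕂 :=
  ∑ i : MsgIdx K, if n ∈ R i.1 then Lagrange.nodalWeight (R i.1) α n *
    ∑ b, ((if i = csaIndex ω then 1 else 0) * (f b - α n)⁻¹ + polyValue (ω.2.1 i b) (α n)) *
      (c (ω.1 i).1 b + (f b - α n) * polyValue ((ω.1 i).2 b) (α n)) else 0

variable {c : (Fin L → F) ≃ (Fin l → 𝕂)} {α : Fin N → 𝕂} {f : Fin l → 𝕂}

lemma card_pow_of_equiv {A B : Type*} [Fintype A] [Fintype B] {l r : ℕ}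
    (h : Fintype.card B = Fintype.card A ^ r) :
    Nonempty ((Fin (l * r) → A) ≃ (Fin l → B)) := by
  refine ⟨Fintype.equivOfCardEq ?_⟩
  simp [h, ← pow_mul, mul_comm]

lemma csaScheme_answer (ω : Sample F K X T L l 𝕂) (n : Fin N) :
    (csaScheme R K X T c α f).answer n ω = csaAnswer R c α f ω n := by
  unfold csaAnswer
  rw [← Finset.sum_filter, Finset.sum_subtype (Finset.univ.filter fun i : MsgIdx K => n ∈ R i.1)
      (p := fun i : MsgIdx K => n ∈ R i.1) (fun i => by simp)]
  rfl

omit [Fintype F] [Nonempty F] [NeZero M] [∀ m, NeZero (K m)] [Fintype 𝕂] in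
/-- The answers combine to evaluations of the desired message. -/
lemma sum_pow_mul_answer (hα : Function.Injective α) (hf : ∀ b n, f b ≠ α n)
    (hl : ∀ m, l + X + T ≤ (R m).card) {j : ℕ} (hj : j < l) (ω : Sample F K X T L l 𝕂) :
    ∑ n, α n ^ j * csaAnswer R c α f ω n =
      ∑ b, c (ω.1 (csaIndex ω)).1 b * (Polynomial.eval (f b)
        (Lagrange.nodal (R (csaIndex ω).1) α))⁻¹ * f b ^ j := by
  obtain ⟨i₀, hi₀⟩ : ∃ i₀, i₀ = csaIndex ω := ⟨_, rfl⟩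
  unfold csaAnswer
  rw [← hi₀]
  simp_rw [Finset.mul_sum]
  rw [Finset.sum_comm]
  -- Each message is interpolated on its own server set with its own weights. As j < l and l + X + T
  -- ≤ |R m| for every m, one family of combinations cancels all undesired messages at once.
  have hinner : ∀ i : MsgIdx K, ∑ n, α n ^ j * (if n ∈ R i.1 then
      ∑ b, Lagrange.nodalWeight (R i.1) α n *
        (((if i = i₀ then 1 else 0) * (f b - α n)⁻¹ + polyValue (ω.2.1 i b) (α n)) *
          (c (ω.1 i).1 b + (f b - α n) * polyValue ((ω.1 i).2 b) (α n))) else 0) =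
      ∑ b, (if i = i₀ then 1 else 0) * c (ω.1 i).1 b * f b ^ j *
        (Polynomial.eval (f b) (Lagrange.nodal (R i.1) α))⁻¹ := by
    intro i
    have hcard := hl i.1
    simp_rw [mul_ite, mul_zero]
    rw [← Finset.sum_filter, Finset.filter_mem_eq_inter, Finset.univ_inter]
    simp_rw [Finset.mul_sum]
    rw [Finset.sum_comm]
    refine Finset.sum_congr rfl fun b _ => ?_
    rw [← sum_nodalWeight_mul (s := R i.1) hα.injOn (fun n _ => hf b n) (j := j) (k₁ := T)
      (k₂ := X) (by omega) (if i = i₀ then 1 else 0) (c (ω.1 i).1 b) (ω.2.1 i b) ((ω.1 i).2 b)]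
    refine Finset.sum_congr rfl fun n _ => ?_
    ring
  rw [Finset.sum_congr rfl fun i _ => hinner i, Finset.sum_eq_single i₀]
  · refine Finset.sum_congr rfl fun b _ => ?_
    rw [if_pos rfl, one_mul]
    ring
  · intro i _ hi
    simp [hi]
  · simp

/-- Security and privacy are one-time pads: a translation of the noise hides data or index from few
servers. Recoverability is interpolation, and correctness is invertibility of the Vandermonde matrix
of the poles. -/
lemma csaScheme_isFeasible (hα : Function.Injective α) (hfi : Function.Injective f)
    (hf : ∀ b n, f b ≠ α n) (hl : ∀ m, l + X + T ≤ (R m).card) (hl0 : 0 < l) (hL : 0 < L)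
    (hq : 1 < Fintype.card F) : (csaScheme R K X T c α f).IsFeasible X T := by
  have hlog : Real.log (Fintype.card F) ≠ 0 :=
    (Real.log_pos (by exact_mod_cast hq)).ne'
  have hne : ∀ b n, f b - α n ≠ 0 := fun b n => sub_ne_zero.2 (hf b n)
  let split : Sample F K X T L l 𝕂 ≃ (MsgIdx K → Fin l → Fin X → 𝕂) × ((MsgIdx K → Fin L → F) ×
      ((MsgIdx K → Fin l → Fin T → 𝕂) × (Fin M × ∀ m, Fin (K m)))) :=
    { toFun := fun ω => (fun i => (ω.1 i).2, (fun i => (ω.1 i).1, ω.2))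
      invFun := fun u => (fun i => (u.2.1 i, u.1 i), u.2.2)
      left_inv := fun _ => rfl
      right_inv := fun _ => rfl }
  let splitMsg : Sample F K X T L l 𝕂 ≃ (MsgIdx K → Fin L → F) × ((MsgIdx K → Fin l → Fin X → 𝕂) ×
      ((MsgIdx K → Fin l → Fin T → 𝕂) × (Fin M × ∀ m, Fin (K m)))) :=
    { toFun := fun ω => (fun i => (ω.1 i).1, (fun i => (ω.1 i).2, ω.2))
      invFun := fun u => (fun i => (u.1 i, u.2.1 i), u.2.2)
      left_inv := fun _ => rfl
      right_inv := fun _ => rfl }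
  let splitQuery : Sample F K X T L l 𝕂 ≃ (MsgIdx K → Fin l → Fin T → 𝕂) ×
      ((MsgIdx K → (Fin L → F) × (Fin l → Fin X → 𝕂)) × (Fin M × ∀ m, Fin (K m))) :=
    { toFun := fun ω => (ω.2.1, (ω.1, ω.2.2))
      invFun := fun u => (u.2.1, (u.1, u.2.2))
      left_inv := fun _ => rfl
      right_inv := fun _ => rfl }
  let splitIndex : Sample F K X T L l 𝕂 ≃ (Fin M × ∀ m, Fin (K m)) ×
      ((MsgIdx K → (Fin L → F) × (Fin l → Fin X → 𝕂)) × (MsgIdx K → Fin l → Fin T → 𝕂)) :=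
    { toFun := fun ω => (ω.2.2, (ω.1, ω.2.1))
      invFun := fun u => (u.2.1, (u.2.2, u.1))
      left_inv := fun _ => rfl
      right_inv := fun _ => rfl }
  refine ⟨hL, ?_, ?_, ?_, ?_, ?_, ?_, ?_, ?_, ?_, ?_⟩
  · intro i
    have h := entropy_uniform_fst (α := Fin L → F) (Fintype.card F)
      (splitMsg.trans ((Equiv.prodCongr (Equiv.funSplitAt i (Fin L → F)) (Equiv.refl _)).trans
        (Equiv.prodAssoc _ _ _))) (Y := fun ω => (ω.1 i).1) (fun ω => rfl)
    change entropy (Fintype.card F) (PMF.uniformOfFintype (Sample F K X T L l 𝕂))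
      (fun ω => (ω.1 i).1) = (L : ℝ)
    refine h.trans ?_
    rw [Fintype.card_fun, Fintype.card_fin, Nat.cast_pow, Real.log_pow, mul_div_cancel_right₀ _ hlog]
  · have h := entropy_uniform_fst (α := MsgIdx K → Fin L → F) (Fintype.card F) splitMsg
      (Y := fun ω i => (ω.1 i).1) (fun ω => rfl)
    change entropy (Fintype.card F) (PMF.uniformOfFintype (Sample F K X T L l 𝕂))
      (fun ω i => (ω.1 i).1) = ∑ m, (K m : ℝ) * (L : ℝ)
    refine h.trans ?_
    rw [Fintype.card_fun, Fintype.card_fun, Fintype.card_fin, ← pow_mul, Nat.cast_pow,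
      Real.log_pow, mul_div_cancel_right₀ _ hlog, Fintype.card_sigma]
    simp only [Fintype.card_fin]
    push_cast
    rw [Finset.mul_sum]
    refine Finset.sum_congr rfl fun m _ => mul_comm _ _
  · exact entropy_uniform_pi (Fintype.card F) (Equiv.refl (Sample F K X T L l 𝕂))
      (Y := (csaScheme R K X T c α f).shares)
      (fun i u n b => c u.1 b + (f b - α n) * polyValue (u.2 b) (α n)) (fun i ω => rfl)
  · intro i
    refine condEntropy_eq_zero_of_determines _ fun ω _ ω' _ h => ?_
    have hval : ∀ ω : Sample F K X T L l 𝕂, ∀ b, ∑ n ∈ (R i.1).attach,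
        Lagrange.nodalWeight (R i.1) α n.1 * ((f b - α n.1)⁻¹ *
          (csaScheme R K X T c α f).shares i ω n b) =
        c (ω.1 i).1 b * (Polynomial.eval (f b) (Lagrange.nodal (R i.1) α))⁻¹ := by
      intro ω b
      have hcard := hl i.1
      -- Recovery from shares alone corresponds to a query without noise: δ = 1 and k₁ = 0.
      have h := sum_nodalWeight_mul (s := R i.1) hα.injOn (fun n _ => hf b n) (j := 0) (k₁ := 0)
        (k₂ := X) (by omega) 1 (c (ω.1 i).1 b) 0 ((ω.1 i).2 b)
      rw [pow_zero, one_mul, mul_one, ← Finset.sum_attach] at h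
      rw [← h]
      refine Finset.sum_congr rfl fun n _ => ?_
      have hz : polyValue (0 : Fin 0 → 𝕂) (α n.1) = 0 := by simp [polyValue]
      rw [hz, one_mul, add_zero, pow_zero, one_mul]
      rfl
    refine c.injective (funext fun b => ?_)
    have h1 := hval ω b
    rw [h, hval ω' b] at h1
    have hn := Lagrange.eval_nodal_not_at_node (s := R i.1) (v := α) (x := f b) fun n _ => hf b n
    exact (mul_right_cancel₀ (inv_ne_zero hn) h1).symm
  · intro 𝒳 h𝒳
    have hex : ∀ (W : MsgIdx K → Fin L → F) (i : MsgIdx K) (b : Fin l), ∃ a : Fin X → 𝕂,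
        ∀ n ∈ 𝒳, polyValue a (α n) = c (W i) b / (f b - α n) := fun W i b =>
      exists_polyValue_eq h𝒳 hα.injOn fun n => c (W i) b / (f b - α n)
    choose t ht using hex
    -- After the shear, the contents of 𝒳 depend only on the translated noise, while the messages
    -- sit in the other factor.
    refine mutualInfo_uniform_eq_zero (Fintype.card F)
      (split.trans (shearEquiv fun u => t u.1))
      (fun Z n i b => (f b - α n) * polyValue (Z i.1 b) (α n)) (fun u => u.1) (fun ω => ?_)
      (fun ω => rfl)
    funext n i b
    change c (ω.1 i.1).1 b + (f b - α n) * polyValue ((ω.1 i.1).2 b) (α n) =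
      (f b - α n) * polyValue ((ω.1 i.1).2 b + t (fun i => (ω.1 i).1) i.1 b) (α n)
    rw [polyValue_add, ht _ _ _ _ n.2, mul_add, mul_div_cancel₀ _ (hne b n), add_comm]
  · rintro rfl i n
    refine ⟨c.toEmbedding, fun ω => ?_⟩
    funext b
    change c (ω.1 i).1 b + (f b - α n) * polyValue ((ω.1 i).2 b) (α n) = c (ω.1 i).1 b
    simp [polyValue]
  · intro i
    change law (PMF.uniformOfFintype (Sample F K X T L l 𝕂))
      (fun ω => (⟨(splitIndex ω).1.1, (splitIndex ω).1.2 (splitIndex ω).1.1⟩ : MsgIdx K)) i = _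
    have : Nonempty ((MsgIdx K → (Fin L → F) × (Fin l → Fin X → 𝕂)) ×
        (MsgIdx K → Fin l → Fin T → 𝕂)) := ⟨(splitIndex (Classical.arbitrary _)).2⟩
    obtain ⟨m, k⟩ := i
    rw [law_uniform_fst splitIndex (fun u => (⟨u.1, u.2 u.1⟩ : MsgIdx K))]
    -- A candidate κ is drawn for every set in advance, so the event θ = (m, k) is the product event
    -- that μ = m and the m-th candidate is k.
    have h1 := law_uniform_pair (Equiv.refl (Fin M × ∀ m, Fin (K m))) (fun m => m)
      (fun v => v m) m k
    have h2 := law_uniform_fst (Equiv.piSplitAt m fun m => Fin (K m)) (fun k => k) k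
    have h3 : law (PMF.uniformOfFintype (∀ m, Fin (K m))) (fun v => v m) k = _ := h2
    rw [law_uniform_id, h3, law_uniform_id, Fintype.card_fin, Fintype.card_fin] at h1
    rw [one_div, mul_inv, ← h1, law_uniform, law_uniform]
    congr 3
    ext u
    simp only [Finset.mem_filter, Finset.mem_univ, true_and, Equiv.refl_apply, Prod.mk.injEq,
      Sigma.mk.injEq]
    refine and_congr_right fun hm => ?_
    subst hm
    simp
  · exact mutualInfo_uniform_eq_zero (Fintype.card F) (Equiv.refl (Sample F K X T L l 𝕂))
      (fun u n i b => c (u i.1).1 b + (f b - α n.1) * polyValue ((u i.1).2 b) (α n.1))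
      (fun v => ((⟨v.2.1, v.2.2 v.2.1⟩ : MsgIdx K), fun (i : MsgIdx K) (n : Fin N) j b =>
        (if j = i then 1 else 0) * (f b - α n)⁻¹ + polyValue (v.1 j b) (α n)))
      (fun ω => rfl) (fun ω => rfl)
  · intro 𝒯 h𝒯
    have hex : ∀ (i j : MsgIdx K) (b : Fin l), ∃ a : Fin T → 𝕂,
        ∀ n ∈ 𝒯, polyValue a (α n) = (if j = i then 1 else 0) * (f b - α n)⁻¹ := fun i j b =>
      exists_polyValue_eq h𝒯 hα.injOn fun n => (if j = i then 1 else 0) * (f b - α n)⁻¹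
    choose t ht using hex
    refine mutualInfo_uniform_eq_zero (Fintype.card F)
      (splitQuery.trans (shearEquiv fun u => t ⟨u.2.1, u.2.2 u.2.1⟩))
      (fun Z n j b => polyValue (Z j b) (α n)) (fun u => ⟨u.2.1, u.2.2 u.2.1⟩) (fun ω => ?_)
      (fun ω => rfl)
    funext n j b
    change (if j = (⟨ω.2.2.1, ω.2.2.2 ω.2.2.1⟩ : MsgIdx K) then 1 else 0) * (f b - α n)⁻¹ +
        polyValue (ω.2.1 j b) (α n) =
      polyValue (ω.2.1 j b + t ⟨ω.2.2.1, ω.2.2.2 ω.2.2.1⟩ j b) (α n)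
    rw [polyValue_add, ht _ _ _ _ n.2, add_comm]
  · refine condEntropy_eq_zero_of_determines _ fun ω _ ω' _ h => ?_
    simp only [Prod.mk.injEq] at h
    obtain ⟨hA, -, hθ⟩ := h
    refine c.injective (funext fun b => ?_)
    have hθ' : csaIndex ω = csaIndex ω' := hθ
    have hA' : csaAnswer R c α f ω = csaAnswer R c α f ω' := by
      funext n
      exact (csaScheme_answer (c := c) (f := f) ω n).symm.trans
        ((congrFun hA n).trans (csaScheme_answer (c := c) (f := f) ω' n))
    -- Equal answers give l vanishing power sums in the distinct poles; the Vandermonde argument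
    -- annihilates every coefficient, and the nodal factors are nonzero.
    have hsum : ∀ j : Fin l, ∑ b,
        ((c (ω.1 (csaIndex ω)).1 b - c (ω'.1 (csaIndex ω')).1 b) * (Polynomial.eval (f b)
          (Lagrange.nodal (R (csaIndex ω').1) α))⁻¹) * f b ^ (j : ℕ) = 0 := by
      intro j
      have h1 := sum_pow_mul_answer (c := c) hα hf hl j.2 ω
      have h2 := sum_pow_mul_answer (c := c) hα hf hl j.2 ω'
      rw [hA', h2, hθ', ← sub_eq_zero, ← Finset.sum_sub_distrib] at h1
      rw [← neg_eq_zero, ← h1, ← Finset.sum_neg_distrib, hθ']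
      refine Finset.sum_congr rfl fun b _ => ?_
      ring
    have hz := congrFun (Matrix.eq_zero_of_forall_pow_sum_mul_pow_eq_zero hfi hsum) b
    have hn := Lagrange.eval_nodal_not_at_node
      (s := R (csaIndex ω').1) (v := α) (x := f b) fun n _ => hf b n
    rw [Pi.zero_apply, mul_eq_zero, or_iff_left (inv_ne_zero hn), sub_eq_zero] at hz
    exact hz

end CrossSubspaceAlignment

/-- Achievability, for any positive numbers of messages. -/
lemma le_capacity {F : Type} [Field F] [Fintype F] {N M : ℕ} {R : Fin M → Finset (Fin N)}
    {X T : ℕ} (hρ : X + T < rhoMin R) {K : Fin M → ℕ} (hK : ∀ m, 0 < K m) :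
    ENNReal.ofReal (((rhoMin R : ℝ) - X - T) / N) ≤ capacity F R X T K := by
  have hq : 1 < Fintype.card F := Fintype.one_lt_card
  have hM := pos_of_lt_rhoMin hρ
  have : NeZero M := ⟨hM.ne'⟩
  have : ∀ m, NeZero (K m) := fun m => ⟨(hK m).ne'⟩
  have hN : 0 < N := (Nat.zero_le _).trans_lt (hρ.trans_le (rhoMin_le_servers hρ))
  obtain ⟨l, hl⟩ : ∃ l, rhoMin R = l + X + T := ⟨rhoMin R - X - T, by omega⟩
  have hl0 : 0 < l := by omega
  have : NeZero (N + l) := ⟨by omega⟩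
  obtain ⟨p, hp⟩ := CharP.exists F
  have hpp : Fact p.Prime := ⟨CharP.char_is_prime F p⟩
  -- Degree N + l suffices for N evaluation points and l poles, as |F|^(N+l) ≥ N + l. A message has
  -- l(N+l) symbols of F and an answer costs at most N + l, so the rate is at least l/N.
  let 𝕂 := FiniteField.Extension F p (N + l)
  have : Fintype 𝕂 := Fintype.ofFinite 𝕂
  have hcard : Fintype.card 𝕂 = Fintype.card F ^ (N + l) := by
    rw [Fintype.card_eq_nat_card, Fintype.card_eq_nat_card]
    exact FiniteField.natCard_extension F p (N + l)
  obtain ⟨c⟩ := card_pow_of_equiv (l := l) hcard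
  obtain ⟨g⟩ : Nonempty (Fin N ⊕ Fin l ↪ 𝕂) := by
    refine Function.Embedding.nonempty_of_card_le ?_
    rw [Fintype.card_sum, Fintype.card_fin, Fintype.card_fin, hcard]
    exact (Nat.lt_pow_self hq).le
  have hfeas := csaScheme_isFeasible (R := R) (K := K) (X := X) (T := T) (c := c)
    (α := fun n => g (Sum.inl n)) (f := fun b => g (Sum.inr b))
    (g.injective.comp Sum.inl_injective) (g.injective.comp Sum.inr_injective)
    (fun b n h => by simpa using g.injective h) (fun m => hl ▸ rhoMin_le m) hl0
    (Nat.mul_pos hl0 (by omega)) hq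
  refine le_trans ?_ (le_iSup₂ (f := fun (s : Scheme F R K) (_ : s.IsFeasible X T) => s.rate)
    _ hfeas)
  set s := csaScheme R K X T c (fun n => g (Sum.inl n)) (fun b => g (Sum.inr b)) with hs
  have hlog : Real.log (Fintype.card F) ≠ 0 := (Real.log_pos (by exact_mod_cast hq)).ne'
  have hdown : s.download ≤ N * ((N + l : ℕ) : ℝ) := by
    have h1 : ∀ n ∈ (Finset.univ : Finset (Fin N)), entropy (Fintype.card F) s.P (s.answer n) ≤
        ((N + l : ℕ) : ℝ) := by
      intro n _
      refine (entropy_le_log_card _ _ _).trans (le_of_eq ?_)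
      have : Fintype.card s.Answer = Fintype.card F ^ (N + l) := hcard
      rw [this, Nat.cast_pow, Real.log_pow, mul_div_cancel_right₀ _ hlog]
    refine (Finset.sum_le_card_nsmul _ _ _ h1).trans (le_of_eq ?_)
    rw [Finset.card_univ, Fintype.card_fin, nsmul_eq_mul]
  have hN' : (0 : ℝ) < N := by exact_mod_cast hN
  have hr : (0 : ℝ) < ((N + l : ℕ) : ℝ) := by exact_mod_cast (by omega : 0 < N + l)
  have hsL : s.L = l * (N + l) := rfl
  calc ENNReal.ofReal (((rhoMin R : ℝ) - X - T) / N)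
      = ENNReal.ofReal ((s.L : ℝ) / (N * ((N + l : ℕ) : ℝ))) := by
        congr 1
        rw [hl, hsL]
        push_cast at hr ⊢
        field_simp
        ring
    _ = (s.L : ℝ≥0∞) / ENNReal.ofReal (N * ((N + l : ℕ) : ℝ)) := by
        rw [ENNReal.ofReal_div_of_pos (by positivity), ENNReal.ofReal_natCast]
    _ ≤ s.rate := ENNReal.div_le_div_left (ENNReal.ofReal_le_ofReal hdown) _

end GXSTPIR

theorem corollary1
    (F : Type) [Field F] [Fintype F]
    (N M : ℕ) (R : Fin M → Finset (Fin N)) (X T : ℕ) (hT : 1 ≤ T)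
    (hρ : X + T < GXSTPIR.rhoMin R)
    (χ : Fin M → ℝ) (hχ : ∀ m, 0 < χ m) :
    -- the two optima and the maximum in the converse bound are attained, and the minimum of the
    -- converse linear program is the fractional matching number
    (IsGreatest (GXSTPIR.matchingWeights (GXSTPIR.hyperedges R X T))
        (GXSTPIR.fractionalMatchingNumber (GXSTPIR.hyperedges R X T)) ∧
      IsLeast (GXSTPIR.totalDownloads R X T)
        (GXSTPIR.fractionalMatchingNumber (GXSTPIR.hyperedges R X T)) ∧
      IsGreatest (GXSTPIR.converseValues R X T) (GXSTPIR.converseBound R X T)) ∧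
    -- the two bounds coincide if and only if
    (GXSTPIR.achievabilityBound R X T = GXSTPIR.converseBound R X T ↔
      GXSTPIR.fractionalMatchingNumber (GXSTPIR.hyperedges R X T) =
        (N : ℝ) / ((GXSTPIR.rhoMin R : ℝ) - X - T)) ∧
    -- and then the asymptotic capacity is
    (GXSTPIR.fractionalMatchingNumber (GXSTPIR.hyperedges R X T) =
        (N : ℝ) / ((GXSTPIR.rhoMin R : ℝ) - X - T) →
      Filter.Tendsto (fun K : ℕ => GXSTPIR.capacity F R X T (fun m => ⌈χ m * K⌉₊))
        Filter.atTop (nhds (ENNReal.ofReal (((GXSTPIR.rhoMin R : ℝ) - X - T) / N)))) := by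
  obtain ⟨-, h1, h2, h3, -⟩ := GXSTPIR.optima hρ
  refine ⟨⟨h1, h2, h3⟩, GXSTPIR.bounds_eq_iff hρ, fun hν => ?_⟩
  have : Nonempty (Fin M) := ⟨⟨0, GXSTPIR.pos_of_lt_rhoMin hρ⟩⟩
  obtain ⟨m₀, hm₀⟩ := Finite.exists_min χ
  -- The smallest number of messages in a set; it tends to infinity, so the error 1/k of the
  -- converse vanishes.
  let k : ℕ → ℕ := fun K => ⌈χ m₀ * K⌉₊
  have hkK : ∀ (K : ℕ) (m : Fin M), k K ≤ ⌈χ m * K⌉₊ := fun K m =>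
    Nat.ceil_mono (mul_le_mul_of_nonneg_right (hm₀ m) (Nat.cast_nonneg K))
  have hk0 : ∀ K : ℕ, 0 < K → 0 < k K := fun K hK =>
    Nat.ceil_pos.2 (mul_pos (hχ m₀) (by exact_mod_cast hK))
  have hkt : Filter.Tendsto (fun K => ((k K : ℕ) : ℝ)⁻¹) Filter.atTop (nhds 0) := by
    refine tendsto_inv_atTop_zero.comp ?_
    refine Filter.tendsto_atTop_mono (fun K => Nat.le_ceil (χ m₀ * K)) ?_
    exact tendsto_natCast_atTop_atTop.const_mul_atTop (hχ m₀)
  have hlim : Filter.Tendsto (fun K => ENNReal.ofReal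
      (((GXSTPIR.rhoMin R : ℝ) - X - T) / N + ((k K : ℕ) : ℝ)⁻¹)) Filter.atTop
      (nhds (ENNReal.ofReal (((GXSTPIR.rhoMin R : ℝ) - X - T) / N))) := by
    refine ENNReal.tendsto_ofReal ?_
    simpa using hkt.const_add (((GXSTPIR.rhoMin R : ℝ) - X - T) / N)
  refine tendsto_of_tendsto_of_tendsto_of_le_of_le' tendsto_const_nhds hlim ?_ ?_
  -- At K = 0 there would be no messages; both bounds need every set nonempty.
  · filter_upwards [Filter.eventually_gt_atTop 0] with K hK
    exact GXSTPIR.le_capacity hρ fun m => (hk0 K hK).trans_le (hkK K m)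
  · filter_upwards [Filter.eventually_gt_atTop 0] with K hK
    have h := GXSTPIR.capacity_le (F := F) Fintype.one_lt_card hT hρ (hk0 K hK) (hkK K)
    rwa [hν, inv_div] at h
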